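/- **Setting.** Let $\mathcal X$ be a measurable space, $n\ge 1$, $d\ge 66$, $\Theta\subseteq\mathbb R^d$ a set containing a Euclidean ball of radius $r_0>0$, and $(p_\theta)_{\theta\in\Theta}$ a family of probability distributions on $\mathcal X$. Assume that $\gamma>0$ satisfies $$\forall \theta_1,\theta_2\in\Theta,\qquad \mathrm{KL}(p_{\theta_1}\|p_{\theta_2})\le\gamma\|\theta_2-\theta_1\|^2 .$$ The (non-private) squared-error minimax risk is $$\mathfrak M_n=\inf_{\hat\theta}\sup_{\theta\in\Theta}\int_{\mathcal X^n}\|\hat\theta(X)-\theta\|^2\,dp_\theta^{\otimes n}(X),$$ the infimum being over measurable $\hat\theta:\mathcal X^n\to\Theta$. For a privacy condition $\mathcal C$, $$\mathfrak M_n(\mathcal C)=\inf_{M}\sup_{\theta\in\Theta}\int_{\mathcal X^n}\mathbb E_M\|M(X)-\theta\|^2\,dp_\theta^{\otimes n}(X),$$ the infimum being over randomized mechanisms (Markov kernels) $M$ from $\mathcal X^n$ to $\Theta$ that satisfy $\mathcal C$. Here $M$ is $\varepsilon$-DP ($\varepsilon>0$) if $\Pr(M(X)\in S)\le e^{\varepsilon}\Pr(M(Y)\in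 S)$ for all measurable $S$, and $\rho$-zCDP ($\rho>0$) if the Rényi divergences satisfy $D_\alpha(M(X)\|M(Y))\le\rho\alpha$ for all $\alpha\in(1,\infty)$, in each case for all $X,Y\in\mathcal X^n$ that differ in at most one coordinate. **(1) Explicit bounds.** Then $$\mathfrak M_n\ \ge\ \frac{d}{32}\,\min\Big(\tfrac{r_0}{\sqrt d},\tfrac1{64\sqrt{n\gamma}}\Big)^2;$$ for every $\varepsilon>0$, $$\mathfrak M_n(\varepsilon\text{-DP})\ \ge\ \frac{d}{32}\,\max\Big(\min\big(\tfrac{r_0}{\sqrt d},\tfrac1{64\sqrt{n\gamma}}\big),\ \min\big(\tfrac{r_0}{\sqrt d},\tfrac{\sqrt d}{64^2\sqrt2\,n\varepsilon\sqrt\gamma}\big)\Big)^2;$$ and for every $0<\rho<1$, $$\mathfrak M_n(\rho\text{-zCDP})\ \ge\ \frac{d}{32}\,\max\Big(\min\big(\tfrac{r_0}{\sqrt d},\tfrac1{64\sqrt{n\gamma}}\big),\ \min\big(\tfrac{r_0}{\sqrt d},\tfrac1{64^2\cdot2\sqrt2\,n\sqrt{\rho\gamma}}\big)\Big)^2 .$$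 **(2) Rates.** Let all objects ($\mathcal X,d,\Theta,p,r_0,\gamma,\varepsilon,\rho$) be sequences indexed by the sample size $n$ that satisfy the above assumptions for each $n$, and suppose that $r_0>C\sqrt d$ for a constant $C>0$. Then, as $n\to\infty$, $$\mathfrak M_n=\Omega\Big(\frac d{n\gamma}\Big),\qquad \mathfrak M_n(\varepsilon\text{-DP})=\Omega\Big(\max\Big\{\frac d{n\gamma},\frac{d^2}{(n\varepsilon)^2\gamma}\Big\}\Big),\qquad \mathfrak M_n(\rho\text{-zCDP})=\Omega\Big(\max\Big\{\frac d{n\gamma},\frac d{n^2\rho\gamma}\Big\}\Big),$$ each under the condition that the rate on its right-hand side is $O(r_0^2)$. (This condition holds in particular when $r_0>C\sqrt d$ and the rate is $O(d)$, for instance when $d,\gamma,\varepsilon,\rho$ do not depend on $n$.) **(3) Gaussian mean estimation.** In particular, let $\Theta=\mathbb R^d$ and $p_\theta=\mathcal N(\theta,\sigma^2I_d)$ with $\sigma>0$, $d\ge66$, $n\ge1$. Then $$\frac{\sigma^2d}{2^{16}n}\le\mathfrak M_n\le\frac{\sigma^2d}{n},\qquad \mathfrak M_n(\varepsilon\text{-DP})\ge\max\Big\{\frac{\sigma^2d}{2^{16}n},\frac{\sigma^2d^2}{2^{29}(n\varepsilon)^2}\Big\}\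 (\varepsilon>0),\qquad \mathfrak M_n(\rho\text{-zCDP})\ge\max\Big\{\frac{\sigma^2d}{2^{16}n},\frac{\sigma^2d}{2^{31}n^2\rho}\Big\}\ (0<\rho<1).$$ -/

import Mathlib

open MeasureTheory ProbabilityTheory Asymptotics Filter
open scoped NNReal ENNReal

universe u

noncomputable section

namespace PrivateMinimax

/-- The Rényi divergence of order `α`; it is `⊤` if `μ` is not absolutely continuous
with respect to `ν`, and the Kullback-Leibler divergence at `α = 1`. -/
def renyiDiv {𝓨 : Type*} [MeasurableSpace 𝓨] (α : ℝ) (μ ν : Measure 𝓨) : EReal :=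
  open Classical in
  if α = 1 then ((InformationTheory.klDiv μ ν : ℝ≥0∞) : EReal)
  else if μ ≪ ν then
    (((α - 1)⁻¹ : ℝ) : EReal) * ENNReal.log (∫⁻ y, (μ.rnDeriv ν y) ^ (α - 1) ∂μ)
  else ⊤

/-- The Hamming distance on `𝓧 ^ n`: the number of coordinates that differ. -/
def ham {𝓧 : Type*} {n : ℕ} (X Y : Fin n → 𝓧) : ℕ :=
  open Classical in hammingDist X Y

/-- `(ε, δ)`-differential privacy of a randomized mechanism on datasets of size `n`;
the mechanism is given by the law `M X` of its output on each dataset `X`. -/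
def IsDP {𝓧 𝓨 : Type*} [MeasurableSpace 𝓧] [MeasurableSpace 𝓨] {n : ℕ} (ε δ : ℝ)
    (M : Kernel (Fin n → 𝓧) 𝓨) : Prop :=
  ∀ X Y : Fin n → 𝓧, ham X Y ≤ 1 → ∀ S : Set 𝓨, MeasurableSet S →
    M X S ≤ ENNReal.ofReal (Real.exp ε) * M Y S + ENNReal.ofReal δ

/-- `ρ`-zero concentrated differential privacy. -/
def IsZCDP {𝓧 𝓨 : Type*} [MeasurableSpace 𝓧] [MeasurableSpace 𝓨] {n : ℕ} (ρ : ℝ)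
    (M : Kernel (Fin n → 𝓧) 𝓨) : Prop :=
  ∀ X Y : Fin n → 𝓧, ham X Y ≤ 1 → ∀ α : ℝ, 1 < α →
    renyiDiv α (M X) (M Y) ≤ ((ρ * α : ℝ) : EReal)

/-- The minimax risk of a family `P` of distributions of the dataset, for a semi-metric `dist`
on the parameter set and a loss function `Φ`; the infimum is over all measurable estimators. -/
def minimaxRisk {𝓧 Θ : Type*} [MeasurableSpace 𝓧] [MeasurableSpace Θ] {n : ℕ}
    (P : Θ → Measure (Fin n → 𝓧)) (dist : Θ → Θ → ℝ≥0) (Φ : ℝ≥0 → ℝ≥0) : ℝ≥0∞ :=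
  ⨅ (est : (Fin n → 𝓧) → Θ) (_ : Measurable est),
    ⨆ θ : Θ, ∫⁻ X, (Φ (dist (est X) θ) : ℝ≥0∞) ∂(P θ)

/-- The private minimax risk: the infimum is over all randomized mechanisms (Markov kernels)
that satisfy the privacy condition `C`. -/
def privateMinimaxRisk {𝓧 Θ : Type*} [MeasurableSpace 𝓧] [MeasurableSpace Θ] {n : ℕ}
    (C : Kernel (Fin n → 𝓧) Θ → Prop)
    (P : Θ → Measure (Fin n → 𝓧)) (dist : Θ → Θ → ℝ≥0) (Φ : ℝ≥0 → ℝ≥0) : ℝ≥0∞ :=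
  ⨅ (M : Kernel (Fin n → 𝓧) Θ) (_ : IsMarkovKernel M) (_ : C M),
    ⨆ θ : Θ, ∫⁻ X, ∫⁻ t, (Φ (dist t θ) : ℝ≥0∞) ∂(M X) ∂(P θ)

/-- The laws of `n` i.i.d. observations. -/
def iidFamily {𝓧 Θ : Type*} [MeasurableSpace 𝓧] (n : ℕ) (p : Θ → Measure 𝓧) :
    Θ → Measure (Fin n → 𝓧) :=
  fun θ => Measure.pi fun _ => p θ

/-- Minimax risk of estimation from `n` i.i.d. observations for the squared Euclidean loss. -/
def sqRisk {𝓧 : Type*} [MeasurableSpace 𝓧] {d : ℕ} (n : ℕ)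
    {Θ : Set (EuclideanSpace ℝ (Fin d))} (p : Θ → Measure 𝓧) : ℝ≥0∞ :=
  minimaxRisk (iidFamily n p)
    (fun θ₁ θ₂ => ‖(θ₁ : EuclideanSpace ℝ (Fin d)) - (θ₂ : EuclideanSpace ℝ (Fin d))‖₊)
    (fun t => t ^ 2)

/-- Private minimax risk of estimation from `n` i.i.d. observations for the squared
Euclidean loss, under the privacy condition `C`. -/
def sqPrivateRisk {𝓧 : Type*} [MeasurableSpace 𝓧] {d : ℕ} (n : ℕ)
    {Θ : Set (EuclideanSpace ℝ (Fin d))} (C : Kernel (Fin n → 𝓧) Θ → Prop)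
    (p : Θ → Measure 𝓧) : ℝ≥0∞ :=
  privateMinimaxRisk C (iidFamily n p)
    (fun θ₁ θ₂ => ‖(θ₁ : EuclideanSpace ℝ (Fin d)) - (θ₂ : EuclideanSpace ℝ (Fin d))‖₊)
    (fun t => t ^ 2)

/-- A family of probability distributions, indexed by a set `Θ` that contains a ball of radius
`r₀`, whose Kullback-Leibler divergences are at most `γ` times the squared distance. -/
structure QuadraticKLModel {𝓧 : Type*} [MeasurableSpace 𝓧] {d : ℕ}
    (Θ : Set (EuclideanSpace ℝ (Fin d))) (p : Θ → Measure 𝓧) (r₀ γ : ℝ) : Prop where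
  isProbabilityMeasure : ∀ θ, IsProbabilityMeasure (p θ)
  radius_pos : 0 < r₀
  exists_ball_subset : ∃ c : EuclideanSpace ℝ (Fin d), Metric.ball c r₀ ⊆ Θ
  gamma_pos : 0 < γ
  klDiv_le : ∀ θ₁ θ₂ : Θ, InformationTheory.klDiv (p θ₁) (p θ₂) ≤
    ENNReal.ofReal (γ * ‖(θ₂ : EuclideanSpace ℝ (Fin d)) - (θ₁ : EuclideanSpace ℝ (Fin d))‖ ^ 2)

/-- The Gaussian location model `(𝓝(θ, σ² I_d))` indexed by all `θ ∈ ℝ^d`. -/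
def gaussianModel (d : ℕ) (σ : ℝ) (θ : (Set.univ : Set (EuclideanSpace ℝ (Fin d)))) :
    Measure (EuclideanSpace ℝ (Fin d)) :=
  multivariateGaussian (θ : EuclideanSpace ℝ (Fin d))
    (σ ^ 2 • (1 : Matrix (Fin d) (Fin d) ℝ))

/-- `a n = Ω(b n)` as `n → ∞`. -/
def IsBigOmega (a : ℕ → ℝ≥0∞) (b : ℕ → ℝ) : Prop :=
  ∃ M : ℝ, 0 < M ∧ ∃ n₀ : ℕ, ∀ n, n₀ ≤ n → ENNReal.ofReal (M * b n) ≤ a n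

end PrivateMinimax

end

/-!
The lower bounds place the vertices `c + δ (±1, …, ±1)` of a cube inside the given ball and bound
the average risk over these vertices.

Everything rests on the Donsker-Varadhan inequality `∫ f ∂p ≤ κ + log ∫ exp f ∂q` for bounded `f`
(`DVBound`), which follows from `KL(p ‖ q) ≤ κ`. It passes to `n`-fold powers with constant `n κ`
by integrating out one coordinate at a time (`DVBound.pi`), and together with Hoeffding's lemma it
gives Pinsker's inequality `∫ f ∂p ≤ ∫ f ∂q + w √(κ / 2)` for `f` of oscillation `w`
(`DVBound.integral_le_add`). Applied to one coordinate of the sample after the other, the latter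
shows that the mean of a function on datasets that changes by at most `L` with each coordinate
moves by at most `n L √(κ / 2)` when `p` is replaced by `q` (`DVBound.integral_pi_le_add`). No
coupling of `p` and `q` and no group privacy is needed. A privacy condition is exactly such a
Lipschitz condition:

* for a `ρ`-zCDP mechanism `M` and a `[0, 1]`-valued `φ`, the function `X ↦ ∫ φ ∂(M X)` changes by
  at most `4 √ρ`, by a second moment bound that uses only the Rényi divergence of order two and
  `ρ < 1`;
* for an `ε`-DP mechanism `M` and `a > 0`, the function `X ↦ log (M X S + a)` changes by at most
  `ε`.

The non-private bound and the zCDP bound follow from Assouad's lemma (`assouad`), since the output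
laws at adjacent vertices have small total variation distance. The `ε`-DP bound, with its
additional factor `d`, needs all vertices at once. Let `S` be the set of outputs within squared
distance `δ² d / 8` of a vertex. Comparing the mean of `log (M X S + a)` under this vertex and under
the centre `c` bounds the probability of `S` under the vertex by that under the centre
(`IsDP.measureReal_comp_mul_neg_log_le`). Since each output is that close to at most a fraction
`exp (- d / 8)` of the vertices (`sum_indicator_cubePoint_le`), the choice `a = exp (- d / 8)` shows
that for some vertex the estimate is good with probability at most `1 / 2` (`cube_fano`). Only
this step needs `d` to be large.

The rates are the explicit bounds up to constants, as `r₀²` dominates the rate. The Gaussian model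
satisfies the assumptions with `γ = 1 / (2 σ²)` and every `r₀`, and its upper bound is the risk of
the sample mean.
-/

namespace PrivateMinimax

/-! ### Change of measure -/

section ChangeOfMeasure

variable {𝓧 : Type*} [MeasurableSpace 𝓧]

/-- The Donsker-Varadhan inequality with constant `κ`, restricted to bounded test functions.
Unlike the divergence itself, this property passes to product measures by a direct induction. -/
def DVBound (κ : ℝ) (p q : Measure 𝓧) : Prop :=
  ∀ f : 𝓧 → ℝ, Measurable f → (∃ C, ∀ x, |f x| ≤ C) →
    ∫ x, f x ∂p ≤ κ + Real.log (∫ x, Real.exp (f x) ∂q)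

lemma integrable_of_bounded {p : Measure 𝓧} [IsFiniteMeasure p] {f : 𝓧 → ℝ}
    (hf : Measurable f) {C : ℝ} (hC : ∀ x, |f x| ≤ C) : Integrable f p :=
  Integrable.of_bound hf.aestronglyMeasurable C (.of_forall hC)

lemma integrable_exp_of_bounded {p : Measure 𝓧} [IsFiniteMeasure p] {f : 𝓧 → ℝ}
    (hf : Measurable f) {C : ℝ} (hC : ∀ x, |f x| ≤ C) :
    Integrable (fun x => Real.exp (f x)) p :=
  integrable_of_bounded hf.exp (C := Real.exp C) fun x => by
    rw [abs_of_pos (Real.exp_pos _)]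
    exact Real.exp_le_exp.2 ((le_abs_self _).trans (hC x))

/-- The Fenchel-Young inequality for the conjugate pair `klFun` and `exp - 1`. -/
lemma mul_le_klFun_add_exp_sub_one {r : ℝ} (hr : 0 ≤ r) (g : ℝ) :
    r * g ≤ InformationTheory.klFun r + (Real.exp g - 1) := by
  rw [InformationTheory.klFun_apply]
  rcases hr.eq_or_lt with rfl | hr
  · simpa using (Real.exp_pos g).le
  have h := Real.add_one_le_exp (g - Real.log r)
  rw [Real.exp_sub, Real.exp_log hr, le_div_iff₀ hr] at h
  linarith

lemma DVBound.of_klDiv_le {p q : Measure 𝓧} [IsProbabilityMeasure p] [IsProbabilityMeasure q]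
    {κ : ℝ} (hκ : 0 ≤ κ) (h : InformationTheory.klDiv p q ≤ ENNReal.ofReal κ) :
    DVBound κ p q := by
  rintro f hf ⟨C, hC⟩
  have hne : InformationTheory.klDiv p q ≠ ∞ := (h.trans_lt ENNReal.ofReal_lt_top).ne
  obtain ⟨hac, hint⟩ := InformationTheory.klDiv_ne_top_iff.1 hne
  have hexp := integrable_exp_of_bounded (p := q) hf hC
  have hpos : 0 < ∫ x, Real.exp (f x) ∂q := integral_exp_pos hexp
  set c := Real.log (∫ x, Real.exp (f x) ∂q) with hc
  -- the normalized test function `g = f - c` satisfies `∫ exp g ∂q = 1`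
  have hexp1 : ∫ x, Real.exp (f x - c) ∂q = 1 := by
    simp_rw [Real.exp_sub, integral_div, hc, Real.exp_log hpos, div_self hpos.ne']
  have hexpg : Integrable (fun x => Real.exp (f x - c)) q := by
    simp_rw [Real.exp_sub]; exact hexp.div_const _
  have hexpg1 : Integrable (fun x => Real.exp (f x - c) - 1) q := hexpg.sub (integrable_const 1)
  have hfp := integrable_of_bounded (p := p) hf hC
  have hgp : Integrable (fun x => f x - c) p := hfp.sub (integrable_const c)
  have hkl := (InformationTheory.integrable_klFun_rnDeriv_iff hac).2 hint
  have key : ∫ x, (p.rnDeriv q x).toReal • (f x - c) ∂q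
      ≤ ∫ x, (InformationTheory.klFun (p.rnDeriv q x).toReal + (Real.exp (f x - c) - 1)) ∂q := by
    refine integral_mono ((integrable_rnDeriv_smul_iff hac).2 hgp)
      (hkl.add hexpg1) fun x => ?_
    exact mul_le_klFun_add_exp_sub_one ENNReal.toReal_nonneg _
  rw [integral_rnDeriv_smul hac, integral_add hkl hexpg1,
    integral_sub hexpg (integrable_const 1), hexp1,
    ← InformationTheory.toReal_klDiv_eq_integral_klFun hac, integral_sub hfp (integrable_const c)]
    at key
  have hle := ENNReal.toReal_le_of_le_ofReal hκ h
  simp at key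
  linarith

/-- Integration against a power measure: integrate out the first coordinate. -/
lemma integral_pi_succ {n : ℕ} (p : Measure 𝓧) [IsProbabilityMeasure p]
    {f : (Fin (n + 1) → 𝓧) → ℝ} (hf : Measurable f) {C : ℝ} (hC : ∀ x, |f x| ≤ C) :
    ∫ X, f X ∂(Measure.pi fun _ => p)
      = ∫ Y, ∫ x, f (Fin.cons x Y) ∂p ∂(Measure.pi fun _ : Fin n => p) := by
  have hmp := (measurePreserving_piFinSuccAbove (fun _ : Fin (n + 1) => p) 0).symm
  rw [← hmp.integral_comp']
  have hm : Measurable fun z : 𝓧 × (Fin n → 𝓧) =>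
      f ((MeasurableEquiv.piFinSuccAbove (fun _ : Fin (n + 1) => 𝓧) 0).symm z) :=
    hf.comp (MeasurableEquiv.measurable _)
  rw [integral_prod_symm _ (integrable_of_bounded hm fun z => hC _)]
  simp [MeasurableEquiv.piFinSuccAbove_symm_apply, Fin.insertNthEquiv]

lemma measurable_fin_cons {n : ℕ} :
    Measurable fun z : 𝓧 × (Fin n → 𝓧) => (Fin.cons z.1 z.2 : Fin (n + 1) → 𝓧) := by
  refine measurable_pi_lambda _ fun i => ?_
  refine Fin.cases ?_ (fun j => ?_) i
  · simpa using measurable_fst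
  · simp only [Fin.cons_succ]; fun_prop

lemma measurable_integral_fin_cons {n : ℕ} (p : Measure 𝓧) [IsProbabilityMeasure p]
    {f : (Fin (n + 1) → 𝓧) → ℝ} (hf : Measurable f) :
    Measurable fun Y : Fin n → 𝓧 => ∫ x, f (Fin.cons x Y) ∂p :=
  (StronglyMeasurable.integral_prod_right (ν := p) (f := fun Y x => f (Fin.cons x Y))
    (hf.comp (measurable_fin_cons.comp measurable_swap)).stronglyMeasurable).measurable

lemma abs_integral_le_of_bounded {p : Measure 𝓧} [IsProbabilityMeasure p] {f : 𝓧 → ℝ}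
    {C : ℝ} (hC : ∀ x, |f x| ≤ C) : |∫ x, f x ∂p| ≤ C := by
  simpa using norm_integral_le_of_norm_le_const (μ := p) (f := f) (C := C) (.of_forall hC)

lemma DVBound.pi {p q : Measure 𝓧} [IsProbabilityMeasure p] [IsProbabilityMeasure q]
    {κ : ℝ} (h : DVBound κ p q) (n : ℕ) :
    DVBound (n * κ) (Measure.pi fun _ : Fin n => p) (Measure.pi fun _ : Fin n => q) := by
  induction n with
  | zero =>
    rintro f - -
    have hs : ∀ X : Fin 0 → 𝓧, f X = f default := fun X => congrArg f (Subsingleton.elim _ _)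
    simp [hs]
  | succ n ih =>
    rintro f hf ⟨C, hC⟩
    have hcons : ∀ Y : Fin n → 𝓧, Measurable fun x => f (Fin.cons x Y) := fun Y =>
      hf.comp (measurable_fin_cons.comp measurable_prodMk_right)
    have hposY : ∀ Y : Fin n → 𝓧, 0 < ∫ x, Real.exp (f (Fin.cons x Y)) ∂q := fun Y =>
      integral_exp_pos (integrable_exp_of_bounded (hcons Y) fun x => hC _)
    -- the log-partition function of the first coordinate is the test function for the others
    set g : (Fin n → 𝓧) → ℝ := fun Y => Real.log (∫ x, Real.exp (f (Fin.cons x Y)) ∂q) with hg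
    have hgm : Measurable g := (measurable_integral_fin_cons q hf.exp).log
    have hgC : ∀ Y, |g Y| ≤ C := by
      intro Y
      have hi := integrable_exp_of_bounded (p := q) (hcons Y) fun x => hC _
      rw [abs_le]
      constructor
      · rw [Real.le_log_iff_exp_le (hposY Y)]
        have := integral_mono (integrable_const (Real.exp (-C))) hi fun x =>
          Real.exp_le_exp.2 (abs_le.1 (hC (Fin.cons x Y))).1
        simpa using this
      · rw [Real.log_le_iff_le_exp (hposY Y)]
        have := integral_mono hi (integrable_const (Real.exp C)) fun x =>
          Real.exp_le_exp.2 (abs_le.1 (hC (Fin.cons x Y))).2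
        simpa using this
    have hexpC : ∀ X, |Real.exp (f X)| ≤ Real.exp C := fun X => by
      rw [abs_of_pos (Real.exp_pos _)]
      exact Real.exp_le_exp.2 (abs_le.1 (hC X)).2
    rw [integral_pi_succ p hf hC, integral_pi_succ q hf.exp hexpC]
    have h1 : ∫ Y, ∫ x, f (Fin.cons x Y) ∂p ∂(Measure.pi fun _ : Fin n => p)
        ≤ ∫ Y, (κ + g Y) ∂(Measure.pi fun _ : Fin n => p) := by
      refine integral_mono (integrable_of_bounded (measurable_integral_fin_cons p hf) fun Y =>
        abs_integral_le_of_bounded fun x => hC _)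
        ((integrable_const κ).add (integrable_of_bounded hgm hgC)) fun Y => ?_
      exact h _ (hcons Y) ⟨C, fun x => hC _⟩
    rw [integral_add (integrable_const κ) (integrable_of_bounded hgm hgC)] at h1
    have h2 := ih g hgm ⟨C, hgC⟩
    have h3 : ∀ Y, Real.exp (g Y) = ∫ x, Real.exp (f (Fin.cons x Y)) ∂q := fun Y =>
      Real.exp_log (hposY Y)
    simp_rw [h3] at h2
    simp at h1
    push_cast
    linarith

/-- Pinsker's inequality, for a test function of oscillation at most `w`. -/
lemma DVBound.integral_le_add {p q : Measure 𝓧} [IsProbabilityMeasure p]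
    [IsProbabilityMeasure q] {κ : ℝ} (hκ : 0 < κ) (h : DVBound κ p q) {f : 𝓧 → ℝ}
    (hf : Measurable f) {w : ℝ} (hw : 0 < w) (hosc : ∀ x y, f x - f y ≤ w) :
    ∫ x, f x ∂p ≤ ∫ x, f x ∂q + w * √(κ / 2) := by
  obtain ⟨x₀⟩ : Nonempty 𝓧 := nonempty_of_isProbabilityMeasure p
  have hbdd : BddBelow (Set.range f) := ⟨f x₀ - w, by rintro _ ⟨x, rfl⟩; linarith [hosc x₀ x]⟩
  have : Nonempty 𝓧 := ⟨x₀⟩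
  set a := ⨅ x, f x with ha
  have hIcc : ∀ x, f x ∈ Set.Icc a (a + w) := fun x =>
    ⟨ciInf_le hbdd x, by
      have : f x - w ≤ a := le_ciInf fun y => by linarith [hosc x y]
      linarith⟩
  have hbound : ∀ x, |f x| ≤ |a| + w := fun x => by
    obtain ⟨h1, h2⟩ := hIcc x
    rw [abs_le]
    constructor <;> linarith [neg_abs_le a, le_abs_self a]
  set m := ∫ x, f x ∂q with hm
  set s := √(κ / 2) with hs
  have hs0 : 0 < s := Real.sqrt_pos.2 (by positivity)
  have hs2 : s ^ 2 = κ / 2 := Real.sq_sqrt (by positivity)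
  -- the optimal exponential parameter
  set t := 4 * s / w with ht
  have hmgf := (hasSubgaussianMGF_of_mem_Icc (μ := q) hf.aemeasurable (.of_forall hIcc)).mgf_le t
  have hgb : ∀ x, |t * (f x - m)| ≤ t * (|a| + w + |m|) := fun x => by
    rw [abs_mul, abs_of_pos (by positivity : 0 < t)]
    gcongr
    exact (abs_sub _ _).trans (by linarith [hbound x])
  have hgm : Measurable fun x => t * (f x - m) := (hf.sub_const m).const_mul t
  have hdv := h _ hgm ⟨_, hgb⟩
  have hpos : 0 < ∫ x, Real.exp (t * (f x - m)) ∂q :=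
    integral_exp_pos (integrable_exp_of_bounded hgm hgb)
  have hlog : Real.log (∫ x, Real.exp (t * (f x - m)) ∂q) ≤ 2 * s ^ 2 := by
    rw [Real.log_le_iff_le_exp hpos]
    refine hmgf.trans (le_of_eq ?_)
    congr 1
    simp [abs_of_pos hw, ht]
    field_simp
    ring
  rw [integral_const_mul, integral_sub (integrable_of_bounded hf hbound) (integrable_const m)]
    at hdv
  have hfin : t * (∫ x, f x ∂p - m) ≤ 4 * s ^ 2 := by simp at hdv; linarith
  have : ∫ x, f x ∂p - m ≤ w * s := by
    have e : 4 * s ^ 2 = t * (w * s) := by rw [ht]; field_simp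
    rw [e] at hfin
    exact le_of_mul_le_mul_left hfin (by positivity)
  linarith

/-- Replacing the sampling distribution one coordinate at a time: each replacement costs at
most `L √(κ / 2)` for a function that changes by at most `L` with each coordinate. -/
lemma DVBound.integral_pi_le_add {p q : Measure 𝓧} [IsProbabilityMeasure p]
    [IsProbabilityMeasure q] {κ : ℝ} (hκ : 0 < κ) (h : DVBound κ p q) {L : ℝ} (hL : 0 < L)
    (n : ℕ) {f : (Fin n → 𝓧) → ℝ} (hf : Measurable f) {C : ℝ} (hC : ∀ X, |f X| ≤ C)
    (hlip : ∀ (X : Fin n → 𝓧) (i : Fin n) (x : 𝓧), f (Function.update X i x) - f X ≤ L) :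
    ∫ X, f X ∂(Measure.pi fun _ : Fin n => p)
      ≤ ∫ X, f X ∂(Measure.pi fun _ : Fin n => q) + n * (L * √(κ / 2)) := by
  induction n with
  | zero =>
    have hs : ∀ X : Fin 0 → 𝓧, f X = f default := fun X => congrArg f (Subsingleton.elim _ _)
    simp [hs]
  | succ n ih =>
    have hcons : ∀ Y : Fin n → 𝓧, Measurable fun x => f (Fin.cons x Y) := fun Y =>
      hf.comp (measurable_fin_cons.comp measurable_prodMk_right)
    have hint : ∀ (r : Measure 𝓧) [IsProbabilityMeasure r] (Y : Fin n → 𝓧),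
        Integrable (fun x => f (Fin.cons x Y)) r := fun r _ Y =>
      integrable_of_bounded (hcons Y) fun x => hC _
    rw [integral_pi_succ p hf hC, integral_pi_succ q hf hC]
    set g : (Fin n → 𝓧) → ℝ := fun Y => ∫ x, f (Fin.cons x Y) ∂q with hg
    have hgm : Measurable g := measurable_integral_fin_cons q hf
    have hgC : ∀ Y, |g Y| ≤ C := fun Y => abs_integral_le_of_bounded fun x => hC _
    have hglip : ∀ (Y : Fin n → 𝓧) (i : Fin n) (y : 𝓧),
        g (Function.update Y i y) - g Y ≤ L := by
      intro Y i y
      rw [hg, ← integral_sub (hint q _) (hint q _)]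
      have := integral_mono ((hint q (Function.update Y i y)).sub (hint q Y))
        (integrable_const L) fun x => by
          have := hlip (Fin.cons x Y) i.succ y
          rwa [← Fin.cons_update] at this
      simpa using this
    have h1 : ∫ Y, ∫ x, f (Fin.cons x Y) ∂p ∂(Measure.pi fun _ : Fin n => p)
        ≤ ∫ Y, (g Y + L * √(κ / 2)) ∂(Measure.pi fun _ : Fin n => p) := by
      refine integral_mono (integrable_of_bounded (measurable_integral_fin_cons p hf) fun Y =>
        abs_integral_le_of_bounded fun x => hC _)
        ((integrable_of_bounded hgm hgC).add (integrable_const _)) fun Y => ?_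
      refine h.integral_le_add hκ (hcons Y) hL fun x y => ?_
      have := hlip (Fin.cons y Y) 0 x
      rwa [Fin.update_cons_zero] at this
    rw [integral_add (integrable_of_bounded hgm hgC) (integrable_const _)] at h1
    have h2 := ih hgm hgC hglip
    simp only [integral_const, probReal_univ, one_smul] at h1
    push_cast
    linarith

end ChangeOfMeasure

/-! ### Privacy as a Lipschitz condition -/

lemma ham_update_le_one {𝓧 : Type*} {n : ℕ} (X : Fin n → 𝓧) (i : Fin n) (x : 𝓧) :
    ham (Function.update X i x) X ≤ 1 := by
  classical
  unfold ham hammingDist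
  refine (Finset.card_le_card (t := {i}) fun j hj => ?_).trans (by simp)
  by_contra hne
  simp at hj hne
  simp [hne] at hj

section Privacy

variable {𝓧 𝓨 : Type*} [MeasurableSpace 𝓧] [MeasurableSpace 𝓨] {n : ℕ}

lemma IsDP.real_le {ε : ℝ} {M : Kernel (Fin n → 𝓧) 𝓨} [IsMarkovKernel M] (h : IsDP ε 0 M)
    {X Y : Fin n → 𝓧} (hXY : ham X Y ≤ 1) {S : Set 𝓨} (hS : MeasurableSet S) :
    (M X).real S ≤ Real.exp ε * (M Y).real S := by
  have h1 := h X Y hXY S hS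
  rw [ENNReal.ofReal_zero, add_zero] at h1
  have h2 := ENNReal.toReal_mono (by finiteness) h1
  rwa [ENNReal.toReal_mul, ENNReal.toReal_ofReal (Real.exp_pos _).le] at h2

lemma lintegral_rnDeriv_le_of_renyiDiv_two_le {μ ν : Measure 𝓨} {r : ℝ}
    (h : renyiDiv 2 μ ν ≤ (r : EReal)) :
    μ ≪ ν ∧ ∫⁻ y, μ.rnDeriv ν y ∂μ ≤ ENNReal.ofReal (Real.exp r) := by
  unfold renyiDiv at h
  rw [if_neg (by norm_num)] at h
  split_ifs at h with hac
  · refine ⟨hac, ?_⟩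
    norm_num at h
    rw [← EReal.exp_coe, ← ENNReal.exp_log (∫⁻ y, μ.rnDeriv ν y ∂μ)]
    exact EReal.exp_le_exp_iff.2 h
  · simp at h

lemma exp_two_mul_sub_one_le {ρ : ℝ} (hρ0 : 0 < ρ) (hρ1 : ρ < 1) :
    Real.exp (2 * ρ) - 1 ≤ 16 * ρ := by
  have h1 := Real.add_one_le_exp (-(2 * ρ))
  have h2 : Real.exp (2 * ρ) * Real.exp (-(2 * ρ)) = 1 := by rw [← Real.exp_add]; simp
  have h3 : Real.exp (2 * ρ) ≤ 8 := by
    have : Real.exp (2 * ρ) ≤ Real.exp 1 ^ 2 := by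
      rw [← Real.exp_nat_mul]; exact Real.exp_le_exp.2 (by push_cast; linarith)
    nlinarith [Real.exp_one_lt_d9, Real.exp_pos 1]
  nlinarith [Real.exp_pos (2 * ρ)]

/-- The total variation distance is controlled by the Rényi divergence of order two, through the
second moment of the density. -/
lemma integral_le_add_of_renyiDiv_two_le {μ ν : Measure 𝓨} [IsProbabilityMeasure μ]
    [IsProbabilityMeasure ν] {ρ : ℝ} (hρ0 : 0 < ρ) (hρ1 : ρ < 1)
    (h : renyiDiv 2 μ ν ≤ ((ρ * 2 : ℝ) : EReal)) {φ : 𝓨 → ℝ} (hφ : Measurable φ)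
    (h0 : ∀ y, 0 ≤ φ y) (h1 : ∀ y, φ y ≤ 1) :
    ∫ y, φ y ∂μ ≤ ∫ y, φ y ∂ν + 4 * √ρ := by
  obtain ⟨hac, hle⟩ := lintegral_rnDeriv_le_of_renyiDiv_two_le h
  set R : 𝓨 → ℝ := fun y => (μ.rnDeriv ν y).toReal with hR
  have hRm : Measurable R := (Measure.measurable_rnDeriv μ ν).ennreal_toReal
  have hRμ : ∫⁻ y, ENNReal.ofReal (R y) ∂μ ≤ ENNReal.ofReal (Real.exp (ρ * 2)) :=
    (lintegral_mono fun y => ENNReal.ofReal_toReal_le).trans hle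
  have hR0 : ∀ y, 0 ≤ R y := fun y => ENNReal.toReal_nonneg
  have hRint : Integrable R μ := by
    refine ⟨hRm.aestronglyMeasurable, ?_⟩
    rw [hasFiniteIntegral_iff_ofReal (.of_forall hR0)]
    exact hRμ.trans_lt ENNReal.ofReal_lt_top
  have hRR : Integrable (fun y => R y * R y) ν := by
    simpa using (integrable_rnDeriv_smul_iff hac).2 hRint
  have hRRle : ∫ y, R y * R y ∂ν ≤ Real.exp (ρ * 2) := by
    have e : ∫ y, R y * R y ∂ν = ∫ y, R y ∂μ := by
      simpa using integral_rnDeriv_smul (f := R) hac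
    rw [e, integral_eq_lintegral_of_nonneg_ae (.of_forall hR0) hRm.aestronglyMeasurable]
    exact ENNReal.toReal_le_of_le_ofReal (Real.exp_pos _).le hRμ
  have hR1 : Integrable R ν := Measure.integrable_toReal_rnDeriv
  have hR1e : ∫ y, R y ∂ν = 1 := by
    simpa using Measure.integral_toReal_rnDeriv hac
  have hφb : ∀ y, |φ y| ≤ 1 := fun y => by rw [abs_of_nonneg (h0 y)]; exact h1 y
  have hφμ := integrable_of_bounded (p := μ) hφ hφb
  have hφν := integrable_of_bounded (p := ν) hφ hφb
  have hRφ : Integrable (fun y => R y * φ y) ν := by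
    simpa using (integrable_rnDeriv_smul_iff hac).2 hφμ
  have hs : 0 < √ρ := Real.sqrt_pos.2 hρ0
  have hs2 : √ρ ^ 2 = ρ := Real.sq_sqrt hρ0.le
  -- the weight `4 √ρ` balances the two terms of the arithmetic-geometric mean inequality
  have hpt : ∀ y, R y * φ y - φ y ≤ (8 * √ρ)⁻¹ * (R y * R y - 2 * R y + 1) + 2 * √ρ := by
    intro y
    have e : (8 * √ρ)⁻¹ * (R y * R y - 2 * R y + 1) + 2 * √ρ
        = (8 * √ρ)⁻¹ * ((R y - 1) ^ 2 + (4 * √ρ) ^ 2) := by field_simp; ring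
    rw [e, inv_mul_eq_div, le_div_iff₀ (by positivity)]
    have ha : R y * φ y - φ y ≤ |R y - 1| := by
      calc R y * φ y - φ y = (R y - 1) * φ y := by ring
        _ ≤ |R y - 1| * φ y := by gcongr; exacts [h0 y, le_abs_self _]
        _ ≤ |R y - 1| * 1 := by gcongr; exact h1 y
        _ = _ := mul_one _
    nlinarith [sq_nonneg (|R y - 1| - 4 * √ρ), sq_abs (R y - 1)]
  have hA0 : Integrable (fun y => R y * R y - 2 * R y) ν := hRR.sub (hR1.const_mul 2)
  have hA : Integrable (fun y => R y * R y - 2 * R y + 1) ν := hA0.add (integrable_const 1)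
  have key := integral_mono (hRφ.sub hφν) ((hA.const_mul _).add (integrable_const _)) hpt
  have eA : ∫ y, (R y * R y - 2 * R y + 1) ∂ν = ∫ y, R y * R y ∂ν - 1 := by
    rw [integral_add hA0 (integrable_const 1),
      integral_sub hRR (hR1.const_mul 2), integral_const_mul, hR1e]
    simp; ring
  have eφ : ∫ y, R y * φ y ∂ν = ∫ y, φ y ∂μ := by
    simpa using integral_rnDeriv_smul (f := φ) hac
  simp only [Pi.sub_apply, Pi.add_apply] at key
  rw [integral_sub hRφ hφν, eφ, integral_add (hA.const_mul _) (integrable_const _),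
    integral_const_mul, eA] at key
  have hbd : (8 * √ρ)⁻¹ * (∫ y, R y * R y ∂ν - 1) ≤ 2 * √ρ := by
    rw [inv_mul_le_iff₀ (by positivity)]
    have := exp_two_mul_sub_one_le hρ0 hρ1
    rw [mul_comm 2 ρ] at this
    nlinarith
  simp only [integral_const, probReal_univ, one_smul] at key
  linarith

lemma measurable_kernel_integral (M : Kernel (Fin n → 𝓧) 𝓨) [IsMarkovKernel M] {φ : 𝓨 → ℝ}
    (hφ : Measurable φ) : Measurable fun X => ∫ y, φ y ∂(M X) :=
  (hφ.stronglyMeasurable.integral_kernel (κ := M)).measurable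

lemma kernel_integral_mem_Icc (M : Kernel (Fin n → 𝓧) 𝓨) [IsMarkovKernel M] {φ : 𝓨 → ℝ}
    (hφ : Measurable φ) (h0 : ∀ y, 0 ≤ φ y) (h1 : ∀ y, φ y ≤ 1) (X : Fin n → 𝓧) :
    ∫ y, φ y ∂(M X) ∈ Set.Icc (0 : ℝ) 1 := by
  refine ⟨integral_nonneg h0, ?_⟩
  have hφb : ∀ y, |φ y| ≤ 1 := fun y => by rw [abs_of_nonneg (h0 y)]; exact h1 y
  simpa using integral_mono (integrable_of_bounded (p := M X) hφ hφb) (integrable_const 1) h1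

lemma integral_kernel_comp (M : Kernel (Fin n → 𝓧) 𝓨) [IsMarkovKernel M]
    (P : Measure (Fin n → 𝓧)) [IsProbabilityMeasure P] {φ : 𝓨 → ℝ}
    (hφ : Measurable φ) {C : ℝ} (hC : ∀ y, |φ y| ≤ C) :
    ∫ y, φ y ∂(P.bind M) = ∫ X, ∫ y, φ y ∂(M X) ∂P := by
  have hint : Integrable φ (P.bind M) := integrable_of_bounded hφ hC
  rw [Measure.comp_eq_comp_const_apply] at hint ⊢
  rw [Kernel.integral_comp hint, Kernel.const_apply]

variable {p q : Measure 𝓧} [IsProbabilityMeasure p] [IsProbabilityMeasure q] {κ : ℝ}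

/-- Without any privacy, the output laws of a mechanism are close as soon as the laws of the
whole sample are. -/
lemma DVBound.integral_comp_le_add (hκ : 0 < κ) (h : DVBound κ p q) (hn : 0 < n)
    (M : Kernel (Fin n → 𝓧) 𝓨) [IsMarkovKernel M] {φ : 𝓨 → ℝ}
    (hφ : Measurable φ) (h0 : ∀ y, 0 ≤ φ y) (h1 : ∀ y, φ y ≤ 1) :
    ∫ y, φ y ∂((Measure.pi fun _ => p).bind M)
      ≤ ∫ y, φ y ∂((Measure.pi fun _ => q).bind M) + √(n * κ / 2) := by
  have hφb : ∀ y, |φ y| ≤ 1 := fun y => by rw [abs_of_nonneg (h0 y)]; exact h1 y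
  rw [integral_kernel_comp M _ hφ hφb, integral_kernel_comp M _ hφ hφb]
  have hI := kernel_integral_mem_Icc M hφ h0 h1
  have := (h.pi n).integral_le_add (by positivity) (measurable_kernel_integral M hφ) one_pos
    fun X Y => by linarith [(hI X).2, (hI Y).1]
  rwa [one_mul] at this

/-- For a zCDP mechanism the swap argument gives a bound linear in the sample size. -/
lemma IsZCDP.integral_comp_le_add (hκ : 0 < κ) (h : DVBound κ p q) {ρ : ℝ} (hρ0 : 0 < ρ)
    (hρ1 : ρ < 1) {M : Kernel (Fin n → 𝓧) 𝓨} [IsMarkovKernel M] (hM : IsZCDP ρ M) {φ : 𝓨 → ℝ}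
    (hφ : Measurable φ) (h0 : ∀ y, 0 ≤ φ y) (h1 : ∀ y, φ y ≤ 1) :
    ∫ y, φ y ∂((Measure.pi fun _ => p).bind M)
      ≤ ∫ y, φ y ∂((Measure.pi fun _ => q).bind M) + n * (4 * √ρ * √(κ / 2)) := by
  have hφb : ∀ y, |φ y| ≤ 1 := fun y => by rw [abs_of_nonneg (h0 y)]; exact h1 y
  rw [integral_kernel_comp M _ hφ hφb, integral_kernel_comp M _ hφ hφb]
  have hI := kernel_integral_mem_Icc M hφ h0 h1
  refine h.integral_pi_le_add hκ (by positivity) n (measurable_kernel_integral M hφ)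
    (C := 1) (fun X => ?_) fun X i x => ?_
  · rw [abs_of_nonneg (hI X).1]; exact (hI X).2
  · have := integral_le_add_of_renyiDiv_two_le hρ0 hρ1
      (hM _ _ (ham_update_le_one X i x) 2 one_lt_two) hφ h0 h1
    linarith

/-- A Fano-type bound for an `ε`-DP mechanism. The function `log (M X S + a)` changes by at most
`ε` with each coordinate of the dataset `X`, hence its mean changes by at most `n ε √(κ / 2)` when
the sampling distribution is replaced. Its mean under `p` is at least
`(1 - Pr (M X ∈ S)) log a` by concavity, and its mean under `q` is at most
`log a + Pr (M X ∈ S) / a`. -/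
lemma IsDP.measureReal_comp_mul_neg_log_le (hκ : 0 < κ) (h : DVBound κ p q) {ε : ℝ}
    (hε : 0 < ε) {M : Kernel (Fin n → 𝓧) 𝓨} [IsMarkovKernel M] (hM : IsDP ε 0 M) {S : Set 𝓨}
    (hS : MeasurableSet S) {a : ℝ} (ha0 : 0 < a) (ha1 : a < 1) :
    ((Measure.pi fun _ => p).bind M).real S * (-Real.log a)
      ≤ n * (ε * √(κ / 2)) + ((Measure.pi fun _ => q).bind M).real S / a := by
  set F : (Fin n → 𝓧) → ℝ := fun X => (M X).real S with hF
  have hFm : Measurable F := (M.measurable_coe hS).ennreal_toReal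
  have hF0 : ∀ X, 0 ≤ F X := fun X => measureReal_nonneg
  have hF1 : ∀ X, F X ≤ 1 := fun X => measureReal_le_one
  have hFb : ∀ X, |F X| ≤ 1 := fun X => by rw [abs_of_nonneg (hF0 X)]; exact hF1 X
  have hcomp : ∀ (r : Measure 𝓧) [IsProbabilityMeasure r],
      ((Measure.pi fun _ => r).bind M).real S = ∫ X, F X ∂(Measure.pi fun _ => r) := by
    intro r _
    have := integral_kernel_comp M (Measure.pi fun _ : Fin n => r)
      (φ := S.indicator fun _ => (1 : ℝ)) (measurable_const.indicator hS) (C := 1)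
      fun y => by by_cases hy : y ∈ S <;> simp [hy]
    simpa [integral_indicator_const _ hS] using this
  rw [hcomp p, hcomp q]
  set G : (Fin n → 𝓧) → ℝ := fun X => Real.log (F X + a) with hG
  have hGm : Measurable G := (hFm.add_const a).log
  have hlog2 : 0 < Real.log 2 := Real.log_pos one_lt_two
  have hla : Real.log a < 0 := Real.log_neg ha0 ha1
  have hGb : ∀ X, |G X| ≤ Real.log 2 - Real.log a := fun X => by
    have h1 : Real.log a ≤ G X := Real.log_le_log ha0 (by linarith [hF0 X])
    have h2 : G X ≤ Real.log 2 :=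
      Real.log_le_log (by linarith [hF0 X]) (by linarith [hF1 X])
    rw [abs_le]; constructor <;> linarith
  have hGlip : ∀ (X : Fin n → 𝓧) (i : Fin n) (x : 𝓧),
      G (Function.update X i x) - G X ≤ ε := fun X i x => by
    have hpos : ∀ Y, 0 < F Y + a := fun Y => by linarith [hF0 Y]
    have h1 : F (Function.update X i x) + a ≤ Real.exp ε * (F X + a) := by
      have := hM.real_le (ham_update_le_one X i x) hS
      nlinarith [Real.add_one_le_exp ε]
    have h2 := Real.log_le_log (hpos _) h1
    rw [Real.log_mul (Real.exp_pos _).ne' (hpos X).ne', Real.log_exp] at h2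
    simp only [hG]; linarith
  have hswap := h.integral_pi_le_add hκ hε n hGm hGb hGlip
  have hlow : ∀ X, (1 - F X) * Real.log a ≤ G X := fun X => by
    have hc := strictConcaveOn_log_Ioi.concaveOn.2 (Set.mem_Ioi.2 ha0)
      (Set.mem_Ioi.2 (by linarith : (0 : ℝ) < 1 + a)) (by linarith [hF1 X] : 0 ≤ 1 - F X) (hF0 X)
      (by ring)
    simp only [smul_eq_mul] at hc
    rw [show (1 - F X) * a + F X * (1 + a) = F X + a by ring] at hc
    have : 0 ≤ F X * Real.log (1 + a) := mul_nonneg (hF0 X) (Real.log_nonneg (by linarith))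
    simp only [hG]; linarith
  have hup : ∀ X, G X ≤ Real.log a + F X / a := fun X => by
    have hpos : 0 < 1 + F X / a := by have := hF0 X; positivity
    have h1 : F X + a = a * (1 + F X / a) := by field_simp; ring
    simp only [hG]
    rw [h1, Real.log_mul ha0.ne' hpos.ne']
    linarith [Real.log_le_sub_one_of_pos hpos]
  have hFp := integrable_of_bounded (p := Measure.pi fun _ : Fin n => p) hFm hFb
  have hFq := integrable_of_bounded (p := Measure.pi fun _ : Fin n => q) hFm hFb
  have h1 := integral_mono (((integrable_const 1).sub hFp).mul_const (Real.log a))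
    (integrable_of_bounded hGm hGb) hlow
  have h2 := integral_mono (integrable_of_bounded hGm hGb)
    ((integrable_const (Real.log a)).add (hFq.div_const a)) hup
  simp only [Pi.sub_apply, Pi.add_apply] at h1 h2
  rw [integral_mul_const, integral_sub (integrable_const 1) hFp] at h1
  rw [integral_add (integrable_const _) (hFq.div_const a), integral_div] at h2
  simp only [integral_const, probReal_univ, one_smul] at h1 h2
  linarith

end Privacy

/-! ### Lower bounds from the vertices of a cube -/

section Cube

variable {d : ℕ}

/-- The vertex of the cube with centre `c` and half-side `δ` whose signs are given by `v`. -/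
noncomputable def cubePoint (c : EuclideanSpace ℝ (Fin d)) (δ : ℝ) (v : Fin d → Bool) :
    EuclideanSpace ℝ (Fin d) :=
  c + WithLp.toLp 2 fun i => if v i then δ else -δ

lemma cubePoint_apply (c : EuclideanSpace ℝ (Fin d)) (δ : ℝ) (v : Fin d → Bool) (i : Fin d) :
    cubePoint c δ v i = c i + if v i then δ else -δ := by
  simp [cubePoint]

/-- The sign vector `v` with its `i`-th sign reversed. -/
def flipSign (v : Fin d → Bool) (i : Fin d) : Fin d → Bool := Function.update v i (!v i)

lemma flipSign_flipSign (v : Fin d → Bool) (i : Fin d) : flipSign (flipSign v i) i = v := by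
  simp [flipSign]

lemma norm_cubePoint_sub_center_sq (c : EuclideanSpace ℝ (Fin d)) (δ : ℝ) (v : Fin d → Bool) :
    ‖cubePoint c δ v - c‖ ^ 2 = δ ^ 2 * d := by
  rw [EuclideanSpace.real_norm_sq_eq]
  have : ∀ i, (cubePoint c δ v - c) i ^ 2 = δ ^ 2 := fun i => by
    rw [PiLp.sub_apply, cubePoint_apply]; split_ifs <;> ring
  simp_rw [this]
  simp [mul_comm]

lemma norm_cubePoint_flipSign_sub_sq (c : EuclideanSpace ℝ (Fin d)) (δ : ℝ) (v : Fin d → Bool)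
    (i : Fin d) : ‖cubePoint c δ (flipSign v i) - cubePoint c δ v‖ ^ 2 = 4 * δ ^ 2 := by
  rw [EuclideanSpace.real_norm_sq_eq, Finset.sum_eq_single i]
  · rw [PiLp.sub_apply, cubePoint_apply, cubePoint_apply]
    cases h : v i <;> simp [flipSign, h] <;> ring
  · intro j _ hj
    rw [PiLp.sub_apply, cubePoint_apply, cubePoint_apply]
    simp [flipSign, Function.update_of_ne hj]
  · simp

lemma enorm_sq_eq_sum (x : EuclideanSpace ℝ (Fin d)) :
    ‖x‖ₑ ^ 2 = ∑ i, ENNReal.ofReal (x i ^ 2) := by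
  rw [← ofReal_norm, ← ENNReal.ofReal_pow (norm_nonneg _), EuclideanSpace.real_norm_sq_eq,
    ENNReal.ofReal_sum_of_nonneg fun i _ => sq_nonneg _]

/-- Le Cam's two-point bound for one coordinate of the cube. -/
lemma two_point_le_lintegral_add {c : EuclideanSpace ℝ (Fin d)} {δ : ℝ} (hδ : 0 < δ)
    (v : Fin d → Bool) (i : Fin d) {Q Q' : Measure (EuclideanSpace ℝ (Fin d))}
    [IsProbabilityMeasure Q] [IsProbabilityMeasure Q']
    (h : ∀ φ : EuclideanSpace ℝ (Fin d) → ℝ, Measurable φ → (∀ t, 0 ≤ φ t) → (∀ t, φ t ≤ 1) →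
      ∫ t, φ t ∂Q' ≤ ∫ t, φ t ∂Q + 1 / 2) :
    ENNReal.ofReal (δ ^ 2) ≤ ∫⁻ t, ENNReal.ofReal ((t - cubePoint c δ v) i ^ 2) ∂Q
      + ∫⁻ t, ENNReal.ofReal ((t - cubePoint c δ (flipSign v i)) i ^ 2) ∂Q' := by
  -- the test that compares the loss at `v` with the least possible total loss `2 δ²`
  set φ : EuclideanSpace ℝ (Fin d) → ℝ :=
    fun t => min 1 ((t - cubePoint c δ v) i ^ 2 / (2 * δ ^ 2)) with hφ
  have hφm : Measurable φ := by
    have : Measurable fun t : EuclideanSpace ℝ (Fin d) => (t - cubePoint c δ v) i := by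
      simp only [PiLp.sub_apply]; fun_prop
    exact measurable_const.min ((this.pow_const 2).div_const _)
  have h0 : ∀ t, 0 ≤ φ t := fun t => le_min zero_le_one (by positivity)
  have h1 : ∀ t, φ t ≤ 1 := fun t => min_le_left _ _
  have hb : ∀ t, |φ t| ≤ 1 := fun t => by rw [abs_of_nonneg (h0 t)]; exact h1 t
  have hδ2 : 0 < 2 * δ ^ 2 := by positivity
  have hle : ∀ t, 2 * δ ^ 2 * φ t ≤ (t - cubePoint c δ v) i ^ 2 := fun t => by
    rw [mul_comm, ← le_div_iff₀ hδ2]; exact min_le_right _ _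
  have hle' : ∀ t, 2 * δ ^ 2 * (1 - φ t) ≤ (t - cubePoint c δ (flipSign v i)) i ^ 2 := fun t => by
    have hpar : 2 * δ ^ 2 ≤ (t - cubePoint c δ v) i ^ 2
        + (t - cubePoint c δ (flipSign v i)) i ^ 2 := by
      rw [PiLp.sub_apply, PiLp.sub_apply, cubePoint_apply, cubePoint_apply]
      cases hv : v i <;> simp [flipSign, hv] <;> nlinarith [sq_nonneg (t i - c i)]
    rcases le_total 1 ((t - cubePoint c δ v) i ^ 2 / (2 * δ ^ 2)) with hc | hc
    · simp only [hφ, min_eq_left hc, sub_self, mul_zero]; positivity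
    · have : 2 * δ ^ 2 * φ t = (t - cubePoint c δ v) i ^ 2 := by
        simp only [hφ, min_eq_right hc]; field_simp
      linarith
  have hiQ := integrable_of_bounded (p := Q) hφm hb
  have hiQ' := integrable_of_bounded (p := Q') hφm hb
  have hiQ1 : Integrable (fun t => 1 - φ t) Q' := (integrable_const 1).sub hiQ'
  have e1 : ENNReal.ofReal (2 * δ ^ 2 * ∫ t, φ t ∂Q)
      ≤ ∫⁻ t, ENNReal.ofReal ((t - cubePoint c δ v) i ^ 2) ∂Q := by
    rw [← integral_const_mul, ofReal_integral_eq_lintegral_ofReal (hiQ.const_mul _)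
      (.of_forall fun t => mul_nonneg hδ2.le (h0 t))]
    exact lintegral_mono fun t => ENNReal.ofReal_le_ofReal (hle t)
  have e2 : ENNReal.ofReal (2 * δ ^ 2 * ∫ t, (1 - φ t) ∂Q')
      ≤ ∫⁻ t, ENNReal.ofReal ((t - cubePoint c δ (flipSign v i)) i ^ 2) ∂Q' := by
    rw [← integral_const_mul, ofReal_integral_eq_lintegral_ofReal
      (hiQ1.const_mul _)
      (.of_forall fun t => mul_nonneg hδ2.le (sub_nonneg.2 (h1 t)))]
    exact lintegral_mono fun t => ENNReal.ofReal_le_ofReal (hle' t)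
  refine le_trans ?_ (add_le_add e1 e2)
  rw [← ENNReal.ofReal_add (mul_nonneg hδ2.le (integral_nonneg h0))
    (mul_nonneg hδ2.le (integral_nonneg fun t => sub_nonneg.2 (h1 t)))]
  refine ENNReal.ofReal_le_ofReal ?_
  rw [integral_sub (integrable_const 1) hiQ']
  have := h φ hφm h0 h1
  simp only [integral_const, probReal_univ, one_smul]
  nlinarith

/-- Assouad's lemma: if the output laws at adjacent vertices have total variation distance at most
`1 / 2`, every coordinate contributes a constant multiple of `δ²` to the risk. -/
lemma assouad {c : EuclideanSpace ℝ (Fin d)} {δ : ℝ} (hδ : 0 < δ)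
    {Q : (Fin d → Bool) → Measure (EuclideanSpace ℝ (Fin d))} [∀ v, IsProbabilityMeasure (Q v)]
    (h : ∀ (v : Fin d → Bool) (i : Fin d) (φ : EuclideanSpace ℝ (Fin d) → ℝ), Measurable φ →
      (∀ t, 0 ≤ φ t) → (∀ t, φ t ≤ 1) → ∫ t, φ t ∂(Q (flipSign v i)) ≤ ∫ t, φ t ∂(Q v) + 1 / 2)
    {R : ℝ≥0∞} (hR : ∀ v, ∫⁻ t, ‖t - cubePoint c δ v‖ₑ ^ 2 ∂(Q v) ≤ R) :
    ENNReal.ofReal (δ ^ 2 * d / 2) ≤ R := by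
  set A : (Fin d → Bool) → Fin d → ℝ≥0∞ :=
    fun v i => ∫⁻ t, ENNReal.ofReal ((t - cubePoint c δ v) i ^ 2) ∂(Q v) with hA
  have hAR : ∀ v, ∑ i, A v i ≤ R := fun v => by
    refine le_trans (le_of_eq ?_) (hR v)
    simp_rw [enorm_sq_eq_sum, hA]
    rw [lintegral_finsetSum]
    intro i _
    simp only [PiLp.sub_apply]
    fun_prop
  have hpair : ∀ v i, ENNReal.ofReal (δ ^ 2) ≤ A v i + A (flipSign v i) i := fun v i =>
    two_point_le_lintegral_add hδ v i (h v i)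
  have hflip : ∀ i, ∑ v, A (flipSign v i) i = ∑ v, A v i := fun i =>
    Equiv.sum_comp (Function.Involutive.toPerm (fun v => flipSign v i)
      fun v => flipSign_flipSign v i) fun v => A v i
  have hsum : (2 : ℝ≥0∞) ^ d * (d * ENNReal.ofReal (δ ^ 2)) ≤ 2 ^ d * (2 * R) := by
    calc (2 : ℝ≥0∞) ^ d * (d * ENNReal.ofReal (δ ^ 2))
        = ∑ i : Fin d, ∑ v : Fin d → Bool, ENNReal.ofReal (δ ^ 2) := by
          simp; ring
      _ ≤ ∑ i : Fin d, ∑ v : Fin d → Bool, (A v i + A (flipSign v i) i) := by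
          gcongr with i _ v; exact hpair v i
      _ = 2 * ∑ v : Fin d → Bool, ∑ i : Fin d, A v i := by
          rw [Finset.sum_comm (s := (Finset.univ : Finset (Fin d → Bool))), Finset.mul_sum]
          refine Finset.sum_congr rfl fun i _ => ?_
          rw [Finset.sum_add_distrib, hflip, two_mul]
      _ ≤ 2 * ∑ v : Fin d → Bool, R := by gcongr with v; exact hAR v
      _ = 2 ^ d * (2 * R) := by simp; ring
  have h2 := (ENNReal.mul_le_mul_iff_right (a := (2 : ℝ≥0∞) ^ d) (by simp) (by simp)).1 hsum
  have e : ENNReal.ofReal (δ ^ 2 * d / 2) = (d * ENNReal.ofReal (δ ^ 2)) / 2 := by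
    rw [ENNReal.ofReal_div_of_pos two_pos, mul_comm, ENNReal.ofReal_mul (by positivity)]
    simp
  rw [e]
  exact ENNReal.div_le_of_le_mul' h2

lemma exp_neg_sub_one_sq_add_le (x : ℝ) :
    Real.exp (-(x - 1) ^ 2) + Real.exp (-(x + 1) ^ 2) ≤ 2 * Real.exp (-(1 / 4)) := by
  have h1 : Real.exp (-1) ≤ 1 / 2 := by
    rw [Real.exp_neg, inv_le_comm₀ (Real.exp_pos _) (by norm_num)]
    linarith [Real.exp_one_gt_d9]
  have h2 := Real.add_one_le_exp (-(1 / 4) : ℝ)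
  rcases le_total 0 x with hx | hx
  · have a : Real.exp (-(x - 1) ^ 2) ≤ 1 := Real.exp_le_one_iff.2 (by nlinarith)
    have b : Real.exp (-(x + 1) ^ 2) ≤ Real.exp (-1) := Real.exp_le_exp.2 (by nlinarith)
    linarith
  · have a : Real.exp (-(x + 1) ^ 2) ≤ 1 := Real.exp_le_one_iff.2 (by nlinarith)
    have b : Real.exp (-(x - 1) ^ 2) ≤ Real.exp (-1) := Real.exp_le_exp.2 (by nlinarith)
    linarith

/-- A ball of squared radius `δ² d / 8` contains an exponentially small fraction of the vertices:
Markov's inequality for `exp (- ‖t - θ‖² / δ²)`, whose sum over the vertices `θ` factorizes. -/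
lemma sum_indicator_cubePoint_le (c : EuclideanSpace ℝ (Fin d)) {δ : ℝ} (hδ : 0 < δ)
    (t : EuclideanSpace ℝ (Fin d)) :
    ∑ v : Fin d → Bool, {s | ‖s - cubePoint c δ v‖ ^ 2 < δ ^ 2 * d / 8}.indicator
      (fun _ => (1 : ℝ)) t ≤ 2 ^ d * Real.exp (-(d / 8)) := by
  set g : Fin d → Bool → ℝ :=
    fun i b => Real.exp (-((t i - (c i + if b then δ else -δ)) / δ) ^ 2) with hg
  have hpt : ∀ v : Fin d → Bool, {s | ‖s - cubePoint c δ v‖ ^ 2 < δ ^ 2 * d / 8}.indicator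
      (fun _ => (1 : ℝ)) t ≤ Real.exp (d / 8) * ∏ i, g i (v i) := by
    intro v
    have hprod : Real.exp (d / 8) * ∏ i, g i (v i)
        = Real.exp (d / 8 - ‖t - cubePoint c δ v‖ ^ 2 / δ ^ 2) := by
      simp only [hg]
      rw [← Real.exp_sum, ← Real.exp_add, EuclideanSpace.real_norm_sq_eq]
      congr 1
      rw [sub_eq_add_neg, Finset.sum_div, ← Finset.sum_neg_distrib]
      congr 1
      refine Finset.sum_congr rfl fun i _ => ?_
      rw [PiLp.sub_apply, cubePoint_apply, div_pow]
    rw [hprod]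
    by_cases hv : t ∈ {s | ‖s - cubePoint c δ v‖ ^ 2 < δ ^ 2 * d / 8}
    · rw [Set.indicator_of_mem hv]
      refine Real.one_le_exp (sub_nonneg.2 ?_)
      rw [div_le_iff₀ (by positivity)]
      have : ‖t - cubePoint c δ v‖ ^ 2 < δ ^ 2 * d / 8 := hv
      linarith
    · rw [Set.indicator_of_notMem hv]; positivity
  have hfac : ∀ i, ∑ b, g i b ≤ 2 * Real.exp (-(1 / 4)) := fun i => by
    have := exp_neg_sub_one_sq_add_le ((t i - c i) / δ)
    rw [Fintype.sum_bool]
    refine le_trans (le_of_eq ?_) this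
    simp only [hg]
    congr 3 <;> · congr 1; simp; field_simp; ring
  calc _ ≤ ∑ v : Fin d → Bool, Real.exp (d / 8) * ∏ i, g i (v i) :=
        Finset.sum_le_sum fun v _ => hpt v
    _ = Real.exp (d / 8) * ∏ i, ∑ b, g i b := by
        rw [← Finset.mul_sum, Finset.prod_univ_sum, Fintype.piFinset_univ]
    _ ≤ Real.exp (d / 8) * ∏ _i : Fin d, (2 * Real.exp (-(1 / 4))) := by
        gcongr with i _
        exact hfac i
    _ = 2 ^ d * Real.exp (-(d / 8)) := by
        rw [Finset.prod_const, Finset.card_univ, Fintype.card_fin, mul_pow, ← Real.exp_nat_mul,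
          mul_left_comm, ← Real.exp_add]
        congr 2; ring

/-- A Fano-type bound: if, for each vertex, the probability of a good estimate is controlled by
the probability that an output with the fixed law `Q₀` is close to this vertex, then for some
vertex the estimate is good with probability at most `1 / 2`. -/
lemma cube_fano (hd : 0 < d) {c : EuclideanSpace ℝ (Fin d)} {δ : ℝ} (hδ : 0 < δ)
    {Q₀ : Measure (EuclideanSpace ℝ (Fin d))} [IsProbabilityMeasure Q₀]
    {Q : (Fin d → Bool) → Measure (EuclideanSpace ℝ (Fin d))} [∀ v, IsProbabilityMeasure (Q v)]
    {K : ℝ} (hK : K + 1 ≤ d / 16)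
    (h : ∀ v, (Q v).real {t | ‖t - cubePoint c δ v‖ ^ 2 < δ ^ 2 * d / 8} * (d / 8)
      ≤ K + Q₀.real {t | ‖t - cubePoint c δ v‖ ^ 2 < δ ^ 2 * d / 8} / Real.exp (-(d / 8)))
    {R : ℝ≥0∞} (hR : ∀ v, ∫⁻ t, ‖t - cubePoint c δ v‖ₑ ^ 2 ∂(Q v) ≤ R) :
    ENNReal.ofReal (δ ^ 2 * d / 16) ≤ R := by
  set B : (Fin d → Bool) → Set (EuclideanSpace ℝ (Fin d)) :=
    fun v => {t | ‖t - cubePoint c δ v‖ ^ 2 < δ ^ 2 * d / 8} with hB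
  have hBm : ∀ v, MeasurableSet (B v) := fun v =>
    measurableSet_lt (by fun_prop) measurable_const
  have hcount : ∑ v, Q₀.real (B v) ≤ 2 ^ d * Real.exp (-(d / 8)) := by
    have e : ∀ v, Q₀.real (B v) = ∫ t, (B v).indicator (fun _ => (1 : ℝ)) t ∂Q₀ := fun v => by
      rw [integral_indicator_const _ (hBm v)]; simp
    have hi : ∀ v, Integrable ((B v).indicator (fun _ => (1 : ℝ))) Q₀ := fun v =>
      (integrable_const 1).indicator (hBm v)
    simp_rw [e]
    rw [← integral_finsetSum _ fun v _ => hi v]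
    have := integral_mono (integrable_finsetSum _ fun v _ => hi v)
      (integrable_const (μ := Q₀) (2 ^ d * Real.exp (-(d / 8)))) fun t => by
        simpa using sum_indicator_cubePoint_le c hδ t
    simpa using this
  have hd' : (0 : ℝ) < d := Nat.cast_pos.2 hd
  obtain ⟨v, -, hv⟩ : ∃ v ∈ (Finset.univ : Finset (Fin d → Bool)), (Q v).real (B v) ≤ 1 / 2 := by
    refine Finset.exists_le_of_sum_le Finset.univ_nonempty ?_
    have h1 : ∑ v, (Q v).real (B v) * (d / 8)
        ≤ ∑ v, (K + Q₀.real (B v) / Real.exp (-(d / 8))) := Finset.sum_le_sum fun v _ => h v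
    rw [← Finset.sum_mul, Finset.sum_add_distrib, ← Finset.sum_div] at h1
    have h2 : (∑ v, Q₀.real (B v)) / Real.exp (-(d / 8)) ≤ 2 ^ d :=
      (div_le_iff₀ (Real.exp_pos _)).2 hcount
    have h3 : (0 : ℝ) < 2 ^ d := by positivity
    simp only [Finset.sum_const, Finset.card_univ, Fintype.card_pi, Fintype.card_bool,
      Finset.prod_const, Fintype.card_fin, nsmul_eq_mul, Nat.cast_pow, Nat.cast_ofNat] at h1 ⊢
    have h4 : (∑ v, (Q v).real (B v)) * (d / 8) ≤ (2 ^ d * (1 / 2)) * (d / 8) := by nlinarith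
    exact le_of_mul_le_mul_right h4 (by positivity)
  refine le_trans ?_ (hR v)
  have hcompl : 1 / 2 ≤ (Q v).real (B v)ᶜ := by
    rw [probReal_compl_eq_one_sub (hBm v)]; linarith
  calc ENNReal.ofReal (δ ^ 2 * d / 16)
      ≤ ENNReal.ofReal (δ ^ 2 * d / 8 * (Q v).real (B v)ᶜ) := by
        refine ENNReal.ofReal_le_ofReal ?_
        have : 0 ≤ δ ^ 2 * d / 8 := by positivity
        nlinarith
    _ = ENNReal.ofReal (δ ^ 2 * d / 8) * Q v (B v)ᶜ := by
        rw [ENNReal.ofReal_mul (by positivity), ofReal_measureReal]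
    _ = ∫⁻ t in (B v)ᶜ, ENNReal.ofReal (δ ^ 2 * d / 8) ∂(Q v) := by simp
    _ ≤ ∫⁻ t in (B v)ᶜ, ‖t - cubePoint c δ v‖ₑ ^ 2 ∂(Q v) := by
        refine setLIntegral_mono (by fun_prop) fun t ht => ?_
        rw [← ofReal_norm, ← ENNReal.ofReal_pow (norm_nonneg _)]
        exact ENNReal.ofReal_le_ofReal (not_lt.1 ht)
    _ ≤ _ := setLIntegral_le_lintegral _ _

end Cube

/-! ### Explicit lower bounds for a quadratic model -/

section Explicit

variable {𝓧 : Type*} [MeasurableSpace 𝓧] {n d : ℕ} {Θ : Set (EuclideanSpace ℝ (Fin d))}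

/-- The largest expected squared error of a randomized mechanism. -/
noncomputable def mechanismRisk (M : Kernel (Fin n → 𝓧) Θ) (p : Θ → Measure 𝓧) : ℝ≥0∞ :=
  ⨆ θ : Θ, ∫⁻ X, ∫⁻ t, ‖(t : EuclideanSpace ℝ (Fin d)) - θ‖ₑ ^ 2 ∂(M X) ∂(iidFamily n p θ)

lemma sqPrivateRisk_eq (C : Kernel (Fin n → 𝓧) Θ → Prop) (p : Θ → Measure 𝓧) :
    sqPrivateRisk n C p = ⨅ (M : Kernel (Fin n → 𝓧) Θ) (_ : IsMarkovKernel M) (_ : C M),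
      mechanismRisk M p := by
  simp only [sqPrivateRisk, privateMinimaxRisk, mechanismRisk, ENNReal.coe_pow, enorm_eq_nnnorm]

/-- A measurable estimator is a mechanism. -/
lemma sqPrivateRisk_true_le_sqRisk (p : Θ → Measure 𝓧) :
    sqPrivateRisk n (fun _ => True) p ≤ sqRisk n p := by
  refine le_iInf₂ fun est hest => ?_
  rw [sqPrivateRisk_eq]
  refine (iInf₂_le (Kernel.deterministic est hest) (Kernel.isMarkovKernel_deterministic hest)).trans
    ((iInf_le _ trivial).trans (le_of_eq ?_))
  unfold mechanismRisk
  congr 1 with θ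
  congr 1 with X
  have hm : Measurable fun t : Θ => ‖(t : EuclideanSpace ℝ (Fin d)) - θ‖ₑ ^ 2 :=
    ((measurable_subtype_coe.sub_const _).enorm).pow_const 2
  rw [Kernel.lintegral_deterministic' hest hm]
  simp [enorm_eq_nnnorm]

/-- The law of the output of a mechanism on a random dataset, as a measure on the whole space. -/
noncomputable def outputLaw (M : Kernel (Fin n → 𝓧) Θ) (P : Measure (Fin n → 𝓧)) :
    Measure (EuclideanSpace ℝ (Fin d)) :=
  (P.bind M).map Subtype.val

instance (M : Kernel (Fin n → 𝓧) Θ) [IsMarkovKernel M] (P : Measure (Fin n → 𝓧))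
    [IsProbabilityMeasure P] : IsProbabilityMeasure (outputLaw M P) :=
  Measure.isProbabilityMeasure_map measurable_subtype_coe.aemeasurable

lemma lintegral_outputLaw_le_mechanismRisk (M : Kernel (Fin n → 𝓧) Θ) (p : Θ → Measure 𝓧)
    (θ : Θ) : ∫⁻ t, ‖t - θ‖ₑ ^ 2 ∂(outputLaw M (Measure.pi fun _ => p θ))
      ≤ mechanismRisk M p := by
  unfold outputLaw
  rw [lintegral_map (by fun_prop) measurable_subtype_coe,
    Measure.lintegral_bind M.aemeasurable (by fun_prop)]
  exact le_iSup (fun θ : Θ => ∫⁻ X, ∫⁻ t, ‖(t : EuclideanSpace ℝ (Fin d)) - θ‖ₑ ^ 2 ∂(M X)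
    ∂(iidFamily n p θ)) θ

lemma integral_outputLaw (M : Kernel (Fin n → 𝓧) Θ) (P : Measure (Fin n → 𝓧))
    {φ : EuclideanSpace ℝ (Fin d) → ℝ} (hφ : Measurable φ) :
    ∫ t, φ t ∂(outputLaw M P) = ∫ t : Θ, φ t ∂(P.bind M) :=
  integral_map measurable_subtype_coe.aemeasurable hφ.aestronglyMeasurable

lemma cubePoint_mem_of_ball_subset {c : EuclideanSpace ℝ (Fin d)} {r₀ δ : ℝ}
    (hc : Metric.ball c r₀ ⊆ Θ) (hδ : 0 < δ) (hr : δ * √d < r₀) (v : Fin d → Bool) :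
    cubePoint c δ v ∈ Θ := by
  refine hc ?_
  rw [mem_ball_iff_norm]
  refine lt_of_pow_lt_pow_left₀ 2 ((by positivity : 0 ≤ δ * √d).trans hr.le) ?_
  rw [norm_cubePoint_sub_center_sq]
  have : (δ * √d) ^ 2 < r₀ ^ 2 := pow_lt_pow_left₀ hr (by positivity) two_ne_zero
  rwa [mul_pow, Real.sq_sqrt (Nat.cast_nonneg d)] at this

variable {p : Θ → Measure 𝓧} {r₀ γ : ℝ}

lemma QuadraticKLModel.dvBound (h : QuadraticKLModel Θ p r₀ γ) {θ₁ θ₂ : Θ} {s : ℝ}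
    (hs : ‖(θ₂ : EuclideanSpace ℝ (Fin d)) - θ₁‖ ^ 2 = s) :
    DVBound (γ * s) (p θ₁) (p θ₂) := by
  have := h.isProbabilityMeasure θ₁
  have := h.isProbabilityMeasure θ₂
  have hγ := h.gamma_pos
  subst hs
  exact DVBound.of_klDiv_le (by positivity) (h.klDiv_le θ₁ θ₂)

/-- The smallness condition makes the laws of the whole sample at adjacent vertices, which are `2 δ`
apart, at most `1 / 2` apart in total variation. -/
lemma QuadraticKLModel.le_mechanismRisk (h : QuadraticKLModel Θ p r₀ γ) (hn : 1 ≤ n) {δ : ℝ}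
    (hδ : 0 < δ) (hr : δ * √d < r₀) (hsmall : n * γ * δ ^ 2 ≤ 1 / 8)
    (M : Kernel (Fin n → 𝓧) Θ) [IsMarkovKernel M] :
    ENNReal.ofReal (δ ^ 2 * d / 2) ≤ mechanismRisk M p := by
  obtain ⟨c, hc⟩ := h.exists_ball_subset
  have := h.isProbabilityMeasure
  have hγ := h.gamma_pos
  have hmem := cubePoint_mem_of_ball_subset hc hδ hr
  refine assouad (c := c) hδ
    (Q := fun v => outputLaw M (Measure.pi fun _ => p ⟨cubePoint c δ v, hmem v⟩))
    (fun v i φ hφ h0 h1 => ?_) fun v => lintegral_outputLaw_le_mechanismRisk M p ⟨_, hmem v⟩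
  rw [integral_outputLaw M _ hφ, integral_outputLaw M _ hφ]
  have hDV : DVBound (γ * (4 * δ ^ 2)) (p ⟨cubePoint c δ (flipSign v i), hmem _⟩)
      (p ⟨cubePoint c δ v, hmem v⟩) := by
    refine h.dvBound ?_
    rw [norm_sub_rev]
    exact norm_cubePoint_flipSign_sub_sq c δ v i
  refine (hDV.integral_comp_le_add (by positivity) hn M (hφ.comp measurable_subtype_coe)
    (fun t => h0 _) fun t => h1 _).trans (add_le_add le_rfl ?_)
  rw [Real.sqrt_le_left (by norm_num)]
  linarith

/-- The smallness condition makes the output laws at adjacent vertices at most `1 / 2` apart in total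
variation. -/
lemma QuadraticKLModel.le_mechanismRisk_of_isZCDP (h : QuadraticKLModel Θ p r₀ γ) {δ : ℝ}
    (hδ : 0 < δ) (hr : δ * √d < r₀) {ρ : ℝ} (hρ0 : 0 < ρ) (hρ1 : ρ < 1)
    (hsmall : n ^ 2 * ρ * γ * δ ^ 2 ≤ 1 / 128)
    (M : Kernel (Fin n → 𝓧) Θ) [IsMarkovKernel M] (hM : IsZCDP ρ M) :
    ENNReal.ofReal (δ ^ 2 * d / 2) ≤ mechanismRisk M p := by
  obtain ⟨c, hc⟩ := h.exists_ball_subset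
  have := h.isProbabilityMeasure
  have hγ := h.gamma_pos
  have hmem := cubePoint_mem_of_ball_subset hc hδ hr
  refine assouad (c := c) hδ
    (Q := fun v => outputLaw M (Measure.pi fun _ => p ⟨cubePoint c δ v, hmem v⟩))
    (fun v i φ hφ h0 h1 => ?_) fun v => lintegral_outputLaw_le_mechanismRisk M p ⟨_, hmem v⟩
  rw [integral_outputLaw M _ hφ, integral_outputLaw M _ hφ]
  have hDV : DVBound (γ * (4 * δ ^ 2)) (p ⟨cubePoint c δ (flipSign v i), hmem _⟩)
      (p ⟨cubePoint c δ v, hmem v⟩) := by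
    refine h.dvBound ?_
    rw [norm_sub_rev]
    exact norm_cubePoint_flipSign_sub_sq c δ v i
  refine (IsZCDP.integral_comp_le_add (by positivity) hDV hρ0 hρ1 hM
    (hφ.comp measurable_subtype_coe) (fun t => h0 _) fun t => h1 _).trans (add_le_add le_rfl ?_)
  refine (pow_le_pow_iff_left₀ (by positivity) (by norm_num) two_ne_zero).1 ?_
  rw [mul_pow, mul_pow, mul_pow, Real.sq_sqrt hρ0.le, Real.sq_sqrt (by positivity)]
  linarith

/-- Here the vertices are compared with the centre of the cube, at distance `δ √d`. The smallness
condition makes the cost of the comparison at most `d / 64`, and `d / 64 + 1 ≤ d / 16` for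
`d ≥ 66`. -/
lemma QuadraticKLModel.le_mechanismRisk_of_isDP (h : QuadraticKLModel Θ p r₀ γ) (hd : 66 ≤ d)
    {δ : ℝ} (hδ : 0 < δ) (hr : δ * √d < r₀) {ε : ℝ} (hε : 0 < ε)
    (hsmall : (n * ε) ^ 2 * γ * δ ^ 2 ≤ d / 2 ^ 11)
    (M : Kernel (Fin n → 𝓧) Θ) [IsMarkovKernel M] (hM : IsDP ε 0 M) :
    ENNReal.ofReal (δ ^ 2 * d / 16) ≤ mechanismRisk M p := by
  obtain ⟨c, hc⟩ := h.exists_ball_subset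
  have := h.isProbabilityMeasure
  have hγ := h.gamma_pos
  have hmem := cubePoint_mem_of_ball_subset hc hδ hr
  have hcΘ : c ∈ Θ := hc (Metric.mem_ball_self h.radius_pos)
  have hd0 : 0 < d := by omega
  have hd1 : (66 : ℝ) ≤ d := by exact_mod_cast hd
  refine cube_fano (c := c) hd0 hδ (Q₀ := outputLaw M (Measure.pi fun _ => p ⟨c, hcΘ⟩))
    (Q := fun v => outputLaw M (Measure.pi fun _ => p ⟨cubePoint c δ v, hmem v⟩))
    (K := n * (ε * √(γ * (δ ^ 2 * d) / 2))) ?_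
    (fun v => ?_) fun v => lintegral_outputLaw_le_mechanismRisk M p ⟨_, hmem v⟩
  · have : n * (ε * √(γ * (δ ^ 2 * d) / 2)) ≤ d / 64 := by
      refine (pow_le_pow_iff_left₀ (by positivity) (by positivity) two_ne_zero).1 ?_
      rw [mul_pow, mul_pow, Real.sq_sqrt (by positivity)]
      nlinarith
    linarith
  · have hDV : DVBound (γ * (δ ^ 2 * d)) (p ⟨cubePoint c δ v, hmem v⟩) (p ⟨c, hcΘ⟩) := by
      refine h.dvBound ?_
      rw [norm_sub_rev]
      exact norm_cubePoint_sub_center_sq c δ v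
    have hS : MeasurableSet {t : EuclideanSpace ℝ (Fin d) |
        ‖t - cubePoint c δ v‖ ^ 2 < δ ^ 2 * d / 8} :=
      measurableSet_lt (by fun_prop) measurable_const
    have := IsDP.measureReal_comp_mul_neg_log_le (n := n) (by positivity) hDV hε hM
      (measurable_subtype_coe hS) (Real.exp_pos (-(d / 8)))
      (Real.exp_lt_one_iff.2 (by linarith))
    rw [Real.log_exp, neg_neg] at this
    unfold outputLaw
    rwa [map_measureReal_apply measurable_subtype_coe hS,
      map_measureReal_apply measurable_subtype_coe hS]

/-- A vertex at distance exactly `r₀` from the centre need not lie in `Θ`. The factor `3 / 4` moves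
the vertices of the cube into the open ball; the loss in the constant is covered by the bounds on
the risk of a mechanism. -/
lemma le_of_forall_lt_radius {r₀ x : ℝ} (hd : 0 < d) (hr₀ : 0 < r₀) (hx : 0 < x) {R : ℝ≥0∞}
    (h : ∀ δ, 0 < δ → δ * √d < r₀ → δ ≤ x → ENNReal.ofReal (δ ^ 2 * d / 16) ≤ R) :
    ENNReal.ofReal ((min (r₀ / √d) x) ^ 2 * d / 32) ≤ R := by
  have hsd : 0 < √(d : ℝ) := Real.sqrt_pos.2 (Nat.cast_pos.2 hd)
  set m := min (r₀ / √d) x with hm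
  have hm0 : 0 < m := lt_min (by positivity) hx
  have hmr : m * √d ≤ r₀ := (le_div_iff₀ hsd).1 (min_le_left _ _)
  refine le_trans (ENNReal.ofReal_le_ofReal ?_)
    (h (3 / 4 * m) (by positivity) (by linarith) (by linarith [min_le_right (r₀ / √d) x]))
  have : 0 ≤ m ^ 2 * d := by positivity
  linarith

lemma QuadraticKLModel.explicit_le_mechanismRisk (h : QuadraticKLModel Θ p r₀ γ) (hn : 1 ≤ n)
    (hd : 66 ≤ d) (M : Kernel (Fin n → 𝓧) Θ) [IsMarkovKernel M] :
    ENNReal.ofReal ((min (r₀ / √d) (1 / (64 * √(n * γ)))) ^ 2 * d / 32)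
      ≤ mechanismRisk M p := by
  have hγ := h.gamma_pos
  have hn' : (0 : ℝ) < n := Nat.cast_pos.2 hn
  refine le_of_forall_lt_radius (by omega) h.radius_pos (by positivity) fun δ hδ hr hx => ?_
  refine (ENNReal.ofReal_le_ofReal ?_).trans (h.le_mechanismRisk hn hδ hr ?_ M)
  · have : 0 ≤ δ ^ 2 * d := by positivity
    linarith
  · have := pow_le_pow_left₀ hδ.le hx 2
    rw [div_pow, mul_pow, Real.sq_sqrt (by positivity), le_div_iff₀ (by positivity)] at this
    linarith

lemma QuadraticKLModel.explicit_le_mechanismRisk_of_isZCDP (h : QuadraticKLModel Θ p r₀ γ)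
    (hn : 1 ≤ n) (hd : 66 ≤ d) {ρ : ℝ} (hρ0 : 0 < ρ) (hρ1 : ρ < 1)
    (M : Kernel (Fin n → 𝓧) Θ) [IsMarkovKernel M] (hM : IsZCDP ρ M) :
    ENNReal.ofReal ((min (r₀ / √d) (1 / (64 ^ 2 * 2 * √2 * n * √(ρ * γ)))) ^ 2 * d / 32)
      ≤ mechanismRisk M p := by
  have hγ := h.gamma_pos
  have hn' : (0 : ℝ) < n := Nat.cast_pos.2 hn
  refine le_of_forall_lt_radius (by omega) h.radius_pos (by positivity) fun δ hδ hr hx => ?_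
  refine (ENNReal.ofReal_le_ofReal ?_).trans
    (h.le_mechanismRisk_of_isZCDP hδ hr hρ0 hρ1 ?_ M hM)
  · have : 0 ≤ δ ^ 2 * d := by positivity
    linarith
  · have := pow_le_pow_left₀ hδ.le hx 2
    rw [div_pow, mul_pow, mul_pow, mul_pow, Real.sq_sqrt (by positivity),
      Real.sq_sqrt (by positivity), le_div_iff₀ (by positivity)] at this
    linarith

lemma QuadraticKLModel.explicit_le_mechanismRisk_of_isDP (h : QuadraticKLModel Θ p r₀ γ)
    (hn : 1 ≤ n) (hd : 66 ≤ d) {ε : ℝ} (hε : 0 < ε)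
    (M : Kernel (Fin n → 𝓧) Θ) [IsMarkovKernel M] (hM : IsDP ε 0 M) :
    ENNReal.ofReal ((min (r₀ / √d) (√d / (64 ^ 2 * √2 * n * ε * √γ))) ^ 2 * d / 32)
      ≤ mechanismRisk M p := by
  have hγ := h.gamma_pos
  have hn' : (0 : ℝ) < n := Nat.cast_pos.2 hn
  have hd' : (0 : ℝ) < d := Nat.cast_pos.2 (by omega)
  refine le_of_forall_lt_radius (by omega) h.radius_pos (by positivity) fun δ hδ hr hx => ?_
  refine h.le_mechanismRisk_of_isDP hd hδ hr hε ?_ M hM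
  have := pow_le_pow_left₀ hδ.le hx 2
  rw [div_pow, mul_pow, mul_pow, mul_pow, mul_pow, Real.sq_sqrt hγ.le,
    Real.sq_sqrt hd'.le, Real.sq_sqrt zero_le_two, le_div_iff₀ (by positivity)] at this
  linarith

lemma ofReal_max_sq_le {a b : ℝ} {R : ℝ≥0∞} (ha : ENNReal.ofReal (a ^ 2 * d / 32) ≤ R)
    (hb : ENNReal.ofReal (b ^ 2 * d / 32) ≤ R) :
    ENNReal.ofReal ((max a b) ^ 2 * d / 32) ≤ R := by
  rcases max_choice a b with h | h <;> rwa [h]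

lemma QuadraticKLModel.explicit_le_sqRisk (h : QuadraticKLModel Θ p r₀ γ) (hn : 1 ≤ n)
    (hd : 66 ≤ d) :
    ENNReal.ofReal ((min (r₀ / √d) (1 / (64 * √(n * γ)))) ^ 2 * d / 32) ≤ sqRisk n p := by
  refine le_trans ?_ (sqPrivateRisk_true_le_sqRisk p)
  rw [sqPrivateRisk_eq]
  exact le_iInf₂ fun M _ => le_iInf fun _ => h.explicit_le_mechanismRisk hn hd M

lemma QuadraticKLModel.explicit_le_sqPrivateRisk_isDP (h : QuadraticKLModel Θ p r₀ γ)
    (hn : 1 ≤ n) (hd : 66 ≤ d) {ε : ℝ} (hε : 0 < ε) :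
    ENNReal.ofReal
        ((max (min (r₀ / √d) (1 / (64 * √(n * γ))))
          (min (r₀ / √d) (√d / (64 ^ 2 * √2 * n * ε * √γ)))) ^ 2 * d / 32)
      ≤ sqPrivateRisk n (IsDP ε 0) p := by
  rw [sqPrivateRisk_eq]
  exact le_iInf₂ fun M _ => le_iInf fun hM => ofReal_max_sq_le
    (h.explicit_le_mechanismRisk hn hd M) (h.explicit_le_mechanismRisk_of_isDP hn hd hε M hM)

lemma QuadraticKLModel.explicit_le_sqPrivateRisk_isZCDP (h : QuadraticKLModel Θ p r₀ γ)
    (hn : 1 ≤ n) (hd : 66 ≤ d) {ρ : ℝ} (hρ0 : 0 < ρ) (hρ1 : ρ < 1) :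
    ENNReal.ofReal
        ((max (min (r₀ / √d) (1 / (64 * √(n * γ))))
          (min (r₀ / √d) (1 / (64 ^ 2 * 2 * √2 * n * √(ρ * γ))))) ^ 2 * d / 32)
      ≤ sqPrivateRisk n (IsZCDP ρ) p := by
  rw [sqPrivateRisk_eq]
  exact le_iInf₂ fun M _ => le_iInf fun hM => ofReal_max_sq_le
    (h.explicit_le_mechanismRisk hn hd M)
    (h.explicit_le_mechanismRisk_of_isZCDP hn hd hρ0 hρ1 M hM)

end Explicit

/-! ### The Gaussian location model -/

section GaussianModel

lemma klDiv_withDensity_exp {𝓧 : Type*} [MeasurableSpace 𝓧] {p q : Measure 𝓧}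
    [IsProbabilityMeasure p] [IsProbabilityMeasure q] {g : 𝓧 → ℝ} (hg : Measurable g)
    (hpq : p = q.withDensity fun x => ENNReal.ofReal (Real.exp (g x))) (hint : Integrable g p) :
    InformationTheory.klDiv p q = ENNReal.ofReal (∫ x, g x ∂p) := by
  have hac : p ≪ q := hpq ▸ withDensity_absolutelyContinuous _ _
  have hrn : p.rnDeriv q =ᵐ[p] fun x => ENNReal.ofReal (Real.exp (g x)) := by
    refine hac.ae_le ?_
    rw [hpq]
    exact Measure.rnDeriv_withDensity q hg.exp.ennreal_ofReal
  have hllr : llr p q =ᵐ[p] g := by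
    filter_upwards [hrn] with x hx
    rw [llr, hx, ENNReal.toReal_ofReal (Real.exp_pos _).le, Real.log_exp]
  rw [InformationTheory.klDiv_of_ac_of_integrable hac ((integrable_congr hllr).2 hint),
    integral_congr_ae hllr]
  simp

/-- The logarithm of the density of `𝓝(a, v)` with respect to `𝓝(b, v)`. -/
noncomputable def gaussianLogRatio (a b v x : ℝ) : ℝ := ((x - b) ^ 2 - (x - a) ^ 2) / (2 * v)

lemma measurable_gaussianLogRatio (a b v : ℝ) : Measurable (gaussianLogRatio a b v) := by
  unfold gaussianLogRatio; fun_prop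

lemma gaussianReal_eq_withDensity (a b : ℝ) {v : ℝ≥0} (hv : v ≠ 0) :
    gaussianReal a v = (gaussianReal b v).withDensity
      fun x => ENNReal.ofReal (Real.exp (gaussianLogRatio a b v x)) := by
  rw [gaussianReal_of_var_ne_zero a hv, gaussianReal_of_var_ne_zero b hv,
    ← withDensity_mul _ (measurable_gaussianPDF b v)
      (measurable_gaussianLogRatio a b v).exp.ennreal_ofReal]
  congr 1 with x
  rw [Pi.mul_apply, gaussianPDF, gaussianPDF, ← ENNReal.ofReal_mul (gaussianPDFReal_nonneg b v x),
    gaussianPDFReal, gaussianPDFReal,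
    mul_assoc _ (Real.exp _) (Real.exp _), ← Real.exp_add, gaussianLogRatio]
  congr 3
  ring

lemma integral_gaussianLogRatio (a b : ℝ) (v : ℝ≥0) :
    Integrable (gaussianLogRatio a b v) (gaussianReal a v) ∧
      ∫ x, gaussianLogRatio a b v x ∂(gaussianReal a v) = (a - b) ^ 2 / (2 * v) := by
  have e : gaussianLogRatio a b v = fun x => (a - b) / v * x + (b ^ 2 - a ^ 2) / (2 * v) := by
    ext x; unfold gaussianLogRatio; ring
  have hid : Integrable (fun x => x) (gaussianReal a v) := IsGaussian.integrable_id
  rw [e]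
  refine ⟨(hid.const_mul _).add (integrable_const _), ?_⟩
  rw [integral_add (hid.const_mul _) (integrable_const _), integral_const_mul,
    integral_id_gaussianReal]
  simp
  ring

lemma pi_gaussianReal_eq_withDensity {d : ℕ} (a b : Fin d → ℝ) {v : ℝ≥0} (hv : v ≠ 0) :
    Measure.pi (fun i => gaussianReal (a i) v)
      = (Measure.pi fun i => gaussianReal (b i) v).withDensity fun x =>
        ENNReal.ofReal (Real.exp (∑ i, gaussianLogRatio (a i) (b i) v (x i))) := by
  set r : Fin d → ℝ → ℝ≥0∞ :=
    fun i x => ENNReal.ofReal (Real.exp (gaussianLogRatio (a i) (b i) v x)) with hr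
  have hrm : ∀ i, Measurable (r i) := fun i =>
    (measurable_gaussianLogRatio _ _ _).exp.ennreal_ofReal
  have hprod : ∀ x : Fin d → ℝ,
      ENNReal.ofReal (Real.exp (∑ i, gaussianLogRatio (a i) (b i) v (x i)))
        = ∏ i, r i (x i) := fun x => by
    rw [Real.exp_sum, ENNReal.ofReal_prod_of_nonneg fun i _ => (Real.exp_pos _).le]
  simp_rw [hprod]
  refine Measure.pi_eq fun s hs => ?_
  have hind : ∀ x : Fin d → ℝ, (Set.univ.pi s).indicator (fun x => ∏ i, r i (x i)) x
      = ∏ i, (s i).indicator (r i) (x i) := fun x => by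
    by_cases hx : x ∈ Set.univ.pi s
    · rw [Set.indicator_of_mem hx]
      exact Finset.prod_congr rfl fun i _ => (Set.indicator_of_mem (hx i trivial) _).symm
    · rw [Set.indicator_of_notMem hx]
      obtain ⟨i, hi⟩ : ∃ i, x i ∉ s i := by simpa [Set.mem_pi] using hx
      exact (Finset.prod_eq_zero (Finset.mem_univ i) (Set.indicator_of_notMem hi _)).symm
  have him : ∀ i, Measurable ((s i).indicator (r i)) := fun i => (hrm i).indicator (hs i)
  rw [withDensity_apply _ (.univ_pi hs), ← lintegral_indicator (.univ_pi hs)]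
  simp_rw [hind]
  rw [lintegral_prod_eq_prod_lintegral_of_indepFun Finset.univ
    (fun i (x : Fin d → ℝ) => (s i).indicator (r i) (x i))
    (iIndepFun_pi fun i => (him i).aemeasurable)
    fun i => (him i).comp (measurable_pi_apply i)]
  refine Finset.prod_congr rfl fun i _ => ?_
  rw [(measurePreserving_eval (fun i => gaussianReal (b i) v) i).lintegral_comp (him i),
    lintegral_indicator (hs i), gaussianReal_eq_withDensity (a i) (b i) hv,
    withDensity_apply _ (hs i)]

variable {d : ℕ}

lemma posSemidef_sq_smul_one (d : ℕ) (σ : ℝ) :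
    (σ ^ 2 • (1 : Matrix (Fin d) (Fin d) ℝ)).PosSemidef :=
  Matrix.PosSemidef.one.smul (sq_nonneg σ)

lemma multivariateGaussian_eq_map_pi (θ : EuclideanSpace ℝ (Fin d)) (σ : ℝ) :
    multivariateGaussian θ (σ ^ 2 • (1 : Matrix (Fin d) (Fin d) ℝ))
      = (Measure.pi fun i => gaussianReal (θ i) (σ ^ 2).toNNReal).map (WithLp.toLp 2) := by
  have hm : Measurable (WithLp.toLp 2 : (Fin d → ℝ) → EuclideanSpace ℝ (Fin d)) := by fun_prop
  have : IsProbabilityMeasure ((Measure.pi fun i : Fin d =>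
      gaussianReal (θ i) (σ ^ 2).toNNReal).map (WithLp.toLp 2)) :=
    Measure.isProbabilityMeasure_map hm.aemeasurable
  refine Measure.ext_of_charFun (E := EuclideanSpace ℝ (Fin d)) ?_
  ext t
  rw [charFun_multivariateGaussian (posSemidef_sq_smul_one d σ), charFun_pi]
  simp_rw [charFun_gaussianReal]
  rw [← Complex.exp_sum]
  congr 1
  simp only [Finset.sum_sub_distrib, PiLp.inner_apply, dotProduct, Matrix.smul_mulVec,
    Matrix.one_mulVec, Real.coe_toNNReal _ (sq_nonneg σ)]
  push_cast
  rw [Finset.sum_mul, Finset.sum_div]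
  simp
  congr 1 <;> exact Finset.sum_congr rfl fun i _ => by ring

lemma klDiv_gaussianModel_le {σ : ℝ} (hσ : 0 < σ)
    (θ₁ θ₂ : (Set.univ : Set (EuclideanSpace ℝ (Fin d)))) :
    InformationTheory.klDiv (gaussianModel d σ θ₁) (gaussianModel d σ θ₂)
      ≤ ENNReal.ofReal (1 / (2 * σ ^ 2) *
        ‖(θ₂ : EuclideanSpace ℝ (Fin d)) - (θ₁ : EuclideanSpace ℝ (Fin d))‖ ^ 2) := by
  have hv : (σ ^ 2).toNNReal ≠ 0 := by simpa using hσ.ne'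
  have hvσ : (((σ ^ 2).toNNReal : ℝ≥0) : ℝ) = σ ^ 2 := Real.coe_toNNReal _ (sq_nonneg σ)
  unfold gaussianModel
  rw [multivariateGaussian_eq_map_pi, multivariateGaussian_eq_map_pi]
  refine (InformationTheory.klDiv_map_le _ _ (by fun_prop)).trans (le_of_eq ?_)
  have hI := fun i : Fin d => integral_gaussianLogRatio (θ₁.1 i) (θ₂.1 i) (σ ^ 2).toNNReal
  have hint : ∀ i : Fin d, Integrable
      (fun x : Fin d → ℝ => gaussianLogRatio (θ₁.1 i) (θ₂.1 i) (σ ^ 2).toNNReal (x i))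
      (Measure.pi fun i => gaussianReal (θ₁.1 i) (σ ^ 2).toNNReal) := fun i =>
    integrable_comp_eval (hI i).1
  rw [klDiv_withDensity_exp
    (Finset.measurable_sum _ fun i _ =>
      (measurable_gaussianLogRatio (θ₁.1 i) (θ₂.1 i) (σ ^ 2).toNNReal).comp
        (measurable_pi_apply i))
    (by simpa using pi_gaussianReal_eq_withDensity (fun i => θ₁.1 i) (fun i => θ₂.1 i) hv)
    (by simpa using integrable_finsetSum _ fun i _ => hint i)]
  congr 1
  simp only [Function.comp_apply]
  rw [integral_finsetSum _ fun i _ => hint i, norm_sub_rev, EuclideanSpace.real_norm_sq_eq,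
    Finset.mul_sum]
  refine Finset.sum_congr rfl fun i _ => ?_
  rw [integral_comp_eval (measurable_gaussianLogRatio _ _ _).aestronglyMeasurable, (hI i).2, hvσ,
    PiLp.sub_apply]
  ring

lemma gaussianModel_quadraticKLModel {σ : ℝ} (hσ : 0 < σ) {r₀ : ℝ} (hr₀ : 0 < r₀) :
    QuadraticKLModel Set.univ (gaussianModel d σ) r₀ (1 / (2 * σ ^ 2)) where
  isProbabilityMeasure θ := by unfold gaussianModel; infer_instance
  radius_pos := hr₀
  exists_ball_subset := ⟨0, Set.subset_univ _⟩
  gamma_pos := by positivity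
  klDiv_le := klDiv_gaussianModel_le hσ

/-- The risk of the sample mean. -/
lemma sqRisk_gaussianModel_le {n : ℕ} (hn : 1 ≤ n) (σ : ℝ) :
    sqRisk n (gaussianModel d σ) ≤ ENNReal.ofReal (σ ^ 2 * d / n) := by
  have hn' : (0 : ℝ) < n := Nat.cast_pos.2 hn
  set est : (Fin n → EuclideanSpace ℝ (Fin d)) → (Set.univ : Set (EuclideanSpace ℝ (Fin d))) :=
    fun X => ⟨(n : ℝ)⁻¹ • ∑ j, X j, trivial⟩ with hest
  have hestm : Measurable est := Measurable.subtype_mk (by fun_prop)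
  refine (iInf₂_le est hestm).trans (iSup_le fun θ => ?_)
  have hp : IsProbabilityMeasure (gaussianModel d σ θ) := by unfold gaussianModel; infer_instance
  set P : Measure (Fin n → EuclideanSpace ℝ (Fin d)) :=
    Measure.pi fun _ => gaussianModel d σ θ with hP
  have hL2 : ∀ i : Fin d, MemLp (fun x : EuclideanSpace ℝ (Fin d) => x i) 2
      (gaussianModel d σ θ) := fun i => by
    unfold gaussianModel
    exact (IsGaussian.memLp_two_id (μ := gaussianReal _ _)).comp_measurePreserving
      (measurePreserving_eval_multivariateGaussian (posSemidef_sq_smul_one d σ) (i := i))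
  have hmean : ∀ i : Fin d, ∫ x, x i ∂(gaussianModel d σ θ) = θ.1 i := fun i => by
    have hmp := measurePreserving_eval_multivariateGaussian (μ := θ.1)
      (posSemidef_sq_smul_one d σ) (i := i)
    have := integral_map (μ := gaussianModel d σ θ) (φ := fun x => x i) (f := fun y : ℝ => y)
      hmp.measurable.aemeasurable (by fun_prop)
    rw [← this]
    unfold gaussianModel
    rw [hmp.map_eq, integral_id_gaussianReal]
  have hvar : ∀ i : Fin d, Var[fun x => x i; gaussianModel d σ θ] = σ ^ 2 := fun i => by
    unfold gaussianModel
    rw [variance_eval_multivariateGaussian (posSemidef_sq_smul_one d σ)]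
    simp
  -- the coordinates of the sample mean
  set Y : Fin d → (Fin n → EuclideanSpace ℝ (Fin d)) → ℝ :=
    fun i X => (n : ℝ)⁻¹ * (∑ j : Fin n, fun X : Fin n → EuclideanSpace ℝ (Fin d) => X j i) X
    with hY
  have hjL2 : ∀ i : Fin d, ∀ j : Fin n,
      MemLp (fun X : Fin n → EuclideanSpace ℝ (Fin d) => X j i) 2 P := fun i j =>
    (hL2 i).comp_measurePreserving (measurePreserving_eval (fun _ => gaussianModel d σ θ) j)
  have hYL2 : ∀ i, MemLp (Y i) 2 P := fun i =>
    (memLp_finsetSum' _ fun j _ => hjL2 i j).const_mul _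
  have hYmean : ∀ i, ∫ X, Y i X ∂P = θ.1 i := fun i => by
    simp only [hY, Finset.sum_apply]
    rw [integral_const_mul, integral_finsetSum _ fun j _ => (hjL2 i j).integrable one_le_two]
    have : ∀ j : Fin n, ∫ X, X j i ∂P = θ.1 i := fun j => by
      rw [← hmean i]
      exact integral_comp_eval (μ := fun _ : Fin n => gaussianModel d σ θ)
        (f := fun x : EuclideanSpace ℝ (Fin d) => x i) (hL2 i).aestronglyMeasurable
    simp [this]
    field_simp
  have hYvar : ∀ i, Var[Y i; P] = σ ^ 2 / n := fun i => by
    simp only [hY]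
    rw [variance_const_mul, hP, variance_sum_pi (fun _ => hL2 i)]
    simp [hvar]
    field_simp
  have hcoord : ∀ X i, ((est X : EuclideanSpace ℝ (Fin d)) - θ) i = Y i X - θ.1 i := fun X i => by
    simp [hest, hY]
  refine le_of_eq ?_
  calc _ = ∫⁻ X, ∑ i, ENNReal.ofReal ((Y i X - θ.1 i) ^ 2) ∂P := by
        refine lintegral_congr fun X => ?_
        rw [ENNReal.coe_pow, ← enorm_eq_nnnorm, enorm_sq_eq_sum]
        simp_rw [hcoord]
    _ = ∑ i, evariance (Y i) P := by
        rw [lintegral_finsetSum' _ fun i _ =>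
          (((hYL2 i).aestronglyMeasurable.aemeasurable.sub_const _).pow_const 2).ennreal_ofReal]
        refine Finset.sum_congr rfl fun i _ => ?_
        rw [evariance_eq_lintegral_ofReal, hYmean i]
    _ = ∑ _i : Fin d, ENNReal.ofReal (σ ^ 2 / n) := by
        refine Finset.sum_congr rfl fun i _ => ?_
        rw [← ofReal_variance (hYL2 i), hYvar i]
    _ = ENNReal.ofReal (σ ^ 2 * d / n) := by
        rw [← ENNReal.ofReal_sum_of_nonneg fun i _ => by positivity]
        congr 1
        simp
        ring

end GaussianModel

/-! ### Rates -/

section Rates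

lemma sq_nonprivateRadius_mul {n d : ℕ} {γ : ℝ} (hγ : 0 < γ) :
    (1 / (64 * √(n * γ))) ^ 2 * d = d / (n * γ) / 2 ^ 12 := by
  rw [div_pow, mul_pow, Real.sq_sqrt (by positivity)]
  ring

lemma sq_dpRadius_mul {n d : ℕ} {ε γ : ℝ} (hγ : 0 < γ) :
    (√d / (64 ^ 2 * √2 * n * ε * √γ)) ^ 2 * d = d ^ 2 / ((n * ε) ^ 2 * γ) / 2 ^ 25 := by
  rw [div_pow, mul_pow, mul_pow, mul_pow, mul_pow, Real.sq_sqrt hγ.le,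
    Real.sq_sqrt (Nat.cast_nonneg d), Real.sq_sqrt zero_le_two]
  ring

lemma sq_zcdpRadius_mul {n d : ℕ} {ρ γ : ℝ} (hρ : 0 < ρ) (hγ : 0 < γ) :
    (1 / (64 ^ 2 * 2 * √2 * n * √(ρ * γ))) ^ 2 * d = d / ((n : ℝ) ^ 2 * ρ * γ) / 2 ^ 27 := by
  rw [div_pow, mul_pow, mul_pow, mul_pow, Real.sq_sqrt zero_le_two, Real.sq_sqrt (by positivity)]
  ring

lemma mul_rate_le_sq_min {d : ℕ} (hd : 0 < d) {r₀ x A K : ℝ}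
    (hK : 0 < K) (hA : 0 ≤ A) (hAr : A ≤ K * r₀ ^ 2) (hAx : A / 2 ^ 27 ≤ x ^ 2 * d) :
    min (1 / K) (1 / 2 ^ 27) / 32 * A ≤ (min (r₀ / √d) x) ^ 2 * d / 32 := by
  have hd' : (0 : ℝ) < d := Nat.cast_pos.2 hd
  rcases min_choice (r₀ / √d) x with h | h <;> rw [h]
  · rw [div_pow, Real.sq_sqrt hd'.le, div_mul_cancel₀ _ hd'.ne']
    have h1 : 1 / K * A ≤ r₀ ^ 2 := by
      rw [one_div, inv_mul_le_iff₀ hK]; exact hAr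
    have h2 := mul_le_mul_of_nonneg_right (min_le_left (1 / K) (1 / 2 ^ 27)) hA
    linarith
  · have h2 := mul_le_mul_of_nonneg_right (min_le_right (1 / K) (1 / 2 ^ 27)) hA
    linarith

lemma mul_max_rate_le {d : ℕ} {a b A B c : ℝ} (ha : 0 ≤ a) (hb : 0 ≤ b)
    (hA : c * A ≤ a ^ 2 * d / 32) (hB : c * B ≤ b ^ 2 * d / 32) : c * max A B ≤ (max a b) ^ 2 * d / 32 := by
  have h1 : a ^ 2 * d / 32 ≤ (max a b) ^ 2 * d / 32 := by gcongr; exact le_max_left _ _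
  have h2 : b ^ 2 * d / 32 ≤ (max a b) ^ 2 * d / 32 := by gcongr; exact le_max_right _ _
  rcases max_choice A B with h | h <;> rw [h]
  exacts [hA.trans h1, hB.trans h2]

/-- With `b ≤ K r₀²` eventually, each explicit bound is at least a constant multiple of the rate:
`2 ^ 27` is the largest of the three numerical constants in the squared radii. -/
lemma isBigOmega_of_explicit {a : ℕ → ℝ≥0∞} {b r₀ L : ℕ → ℝ}
    (ha : ∀ n, 1 ≤ n → ENNReal.ofReal (L n) ≤ a n) (hO : b =O[atTop] fun n => r₀ n ^ 2)
    (hL : ∀ n, 1 ≤ n → ∀ K, 0 < K → b n ≤ K * r₀ n ^ 2 →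
      min (1 / K) (1 / 2 ^ 27) / 32 * b n ≤ L n) : IsBigOmega a b := by
  obtain ⟨K, hK, hbound⟩ := hO.exists_pos
  obtain ⟨N, hN⟩ := eventually_atTop.1 hbound.bound
  refine ⟨min (1 / K) (1 / 2 ^ 27) / 32, by positivity, max N 1, fun n hn => ?_⟩
  have hn1 : 1 ≤ n := (le_max_right _ _).trans hn
  refine (ENNReal.ofReal_le_ofReal (hL n hn1 K hK ?_)).trans (ha n hn1)
  have := hN n ((le_max_left _ _).trans hn)
  rw [Real.norm_of_nonneg (sq_nonneg (r₀ n))] at this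
  exact (le_abs_self _).trans this

variable {𝓧 : ℕ → Type*} [∀ n, MeasurableSpace (𝓧 n)] {d : ℕ → ℕ}
  {Θ : ∀ n, Set (EuclideanSpace ℝ (Fin (d n)))} {p : ∀ n, Θ n → Measure (𝓧 n)} {r₀ γ : ℕ → ℝ}

lemma isBigOmega_sqRisk (hd : ∀ n, 66 ≤ d n)
    (h : ∀ n, QuadraticKLModel (Θ n) (p n) (r₀ n) (γ n))
    (hO : (fun n : ℕ => (d n : ℝ) / (n * γ n)) =O[atTop] fun n => r₀ n ^ 2) :
    IsBigOmega (fun n => sqRisk n (p n)) fun n => (d n : ℝ) / (n * γ n) := by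
  refine isBigOmega_of_explicit (fun n hn => (h n).explicit_le_sqRisk hn (hd n)) hO
    fun n hn K hK hb => ?_
  have hγ := (h n).gamma_pos
  have hdn : 0 < d n := by linarith [hd n]
  refine mul_rate_le_sq_min hdn hK (by positivity) hb ?_
  rw [sq_nonprivateRadius_mul hγ]
  exact div_le_div_of_nonneg_left (by positivity) (by positivity) (by norm_num)

lemma isBigOmega_sqPrivateRisk_isDP (hd : ∀ n, 66 ≤ d n)
    (h : ∀ n, QuadraticKLModel (Θ n) (p n) (r₀ n) (γ n)) {ε : ℕ → ℝ} (hε : ∀ n, 0 < ε n)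
    (hO : (fun n : ℕ => max ((d n : ℝ) / (n * γ n)) ((d n : ℝ) ^ 2 / ((n * ε n) ^ 2 * γ n)))
      =O[atTop] fun n => r₀ n ^ 2) :
    IsBigOmega (fun n => sqPrivateRisk n (IsDP (ε n) 0) (p n))
      fun n => max ((d n : ℝ) / (n * γ n)) ((d n : ℝ) ^ 2 / ((n * ε n) ^ 2 * γ n)) := by
  refine isBigOmega_of_explicit
    (fun n hn => (h n).explicit_le_sqPrivateRisk_isDP hn (hd n) (hε n)) hO fun n hn K hK hb => ?_
  have hγ := (h n).gamma_pos
  have hr := (h n).radius_pos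
  have hεn := hε n
  have hdn : 0 < d n := by linarith [hd n]
  refine mul_max_rate_le (le_min (by positivity) (by positivity))
    (le_min (by positivity) (by positivity)) ?_ ?_
  · refine mul_rate_le_sq_min hdn hK (by positivity)
      ((le_max_left _ _).trans hb) ?_
    rw [sq_nonprivateRadius_mul hγ]
    exact div_le_div_of_nonneg_left (by positivity) (by positivity) (by norm_num)
  · refine mul_rate_le_sq_min hdn hK (by positivity)
      ((le_max_right _ _).trans hb) ?_
    rw [sq_dpRadius_mul hγ]
    exact div_le_div_of_nonneg_left (by positivity) (by positivity) (by norm_num)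

lemma isBigOmega_sqPrivateRisk_isZCDP (hd : ∀ n, 66 ≤ d n)
    (h : ∀ n, QuadraticKLModel (Θ n) (p n) (r₀ n) (γ n)) {ρ : ℕ → ℝ} (hρ0 : ∀ n, 0 < ρ n)
    (hρ1 : ∀ n, ρ n < 1)
    (hO : (fun n : ℕ => max ((d n : ℝ) / (n * γ n)) ((d n : ℝ) / ((n : ℝ) ^ 2 * ρ n * γ n)))
      =O[atTop] fun n => r₀ n ^ 2) :
    IsBigOmega (fun n => sqPrivateRisk n (IsZCDP (ρ n)) (p n))
      fun n => max ((d n : ℝ) / (n * γ n)) ((d n : ℝ) / ((n : ℝ) ^ 2 * ρ n * γ n)) := by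
  refine isBigOmega_of_explicit
    (fun n hn => (h n).explicit_le_sqPrivateRisk_isZCDP hn (hd n) (hρ0 n) (hρ1 n)) hO
    fun n hn K hK hb => ?_
  have hγ := (h n).gamma_pos
  have hr := (h n).radius_pos
  have hρn := hρ0 n
  have hdn : 0 < d n := by linarith [hd n]
  refine mul_max_rate_le (le_min (by positivity) (by positivity))
    (le_min (by positivity) (by positivity)) ?_ ?_
  · refine mul_rate_le_sq_min hdn hK (by positivity)
      ((le_max_left _ _).trans hb) ?_
    rw [sq_nonprivateRadius_mul hγ]
    exact div_le_div_of_nonneg_left (by positivity) (by positivity) (by norm_num)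
  · refine mul_rate_le_sq_min hdn hK (by positivity)
      ((le_max_right _ _).trans hb) ?_
    rw [sq_zcdpRadius_mul hρn hγ]

end Rates

/-! ### Explicit bounds for Gaussian mean estimation -/

section GaussianBounds

variable {n d : ℕ} {σ : ℝ}

lemma le_sqRisk_gaussianModel (hn : 1 ≤ n) (hd : 66 ≤ d) (hσ : 0 < σ) :
    ENNReal.ofReal (σ ^ 2 * d / (2 ^ 16 * n)) ≤ sqRisk n (gaussianModel d σ) := by
  have hn' : (0 : ℝ) < n := Nat.cast_pos.2 hn
  have hd' : (0 : ℝ) < d := Nat.cast_pos.2 (by omega)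
  set γ := 1 / (2 * σ ^ 2) with hγ
  have hγ0 : 0 < γ := by positivity
  set x := 1 / (64 * √(n * γ)) with hx
  have hx0 : 0 < x := by positivity
  -- the parameter space is unbounded, so the radius can be taken as large as needed
  have h := (gaussianModel_quadraticKLModel (d := d) hσ
    (mul_pos hx0 (Real.sqrt_pos.2 hd'))).explicit_le_sqRisk hn hd
  rw [← hγ, ← hx, mul_div_cancel_right₀ _ (Real.sqrt_pos.2 hd').ne', min_self, hx,
    sq_nonprivateRadius_mul hγ0] at h
  refine le_trans (le_of_eq ?_) h
  congr 1
  rw [hγ]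
  field_simp
  norm_num

lemma le_sqPrivateRisk_isDP_gaussianModel (hn : 1 ≤ n) (hd : 66 ≤ d) (hσ : 0 < σ) {ε : ℝ}
    (hε : 0 < ε) :
    ENNReal.ofReal (max (σ ^ 2 * d / (2 ^ 16 * n)) (σ ^ 2 * d ^ 2 / (2 ^ 29 * (n * ε) ^ 2)))
      ≤ sqPrivateRisk n (IsDP ε 0) (gaussianModel d σ) := by
  have hn' : (0 : ℝ) < n := Nat.cast_pos.2 hn
  have hd' : (0 : ℝ) < d := Nat.cast_pos.2 (by omega)
  set γ := 1 / (2 * σ ^ 2) with hγ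
  have hγ0 : 0 < γ := by positivity
  set x := 1 / (64 * √(n * γ)) with hx
  set y := √d / (64 ^ 2 * √2 * n * ε * √γ) with hy
  have hx0 : 0 < x := by positivity
  have hy0 : 0 < y := by positivity
  have h := (gaussianModel_quadraticKLModel (d := d) hσ
    (mul_pos (lt_max_of_lt_left hx0 : 0 < max x y)
      (Real.sqrt_pos.2 hd'))).explicit_le_sqPrivateRisk_isDP hn hd hε
  rw [← hγ, ← hx, ← hy, mul_div_cancel_right₀ _ (Real.sqrt_pos.2 hd').ne',
    min_eq_right (le_max_left x y), min_eq_right (le_max_right x y)] at h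
  refine le_trans (ENNReal.ofReal_le_ofReal ?_) h
  have key := mul_max_rate_le (d := d) (c := 1) (A := σ ^ 2 * d / (2 ^ 16 * n))
    (B := σ ^ 2 * d ^ 2 / (2 ^ 29 * (n * ε) ^ 2)) hx0.le hy0.le ?_ ?_
  · rwa [one_mul] at key
  · rw [hx, sq_nonprivateRadius_mul hγ0, hγ]
    refine le_of_eq ?_
    field_simp
    norm_num
  · rw [hy, sq_dpRadius_mul hγ0, hγ]
    refine le_of_eq ?_
    field_simp
    norm_num

lemma le_sqPrivateRisk_isZCDP_gaussianModel (hn : 1 ≤ n) (hd : 66 ≤ d) (hσ : 0 < σ) {ρ : ℝ}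
    (hρ0 : 0 < ρ) (hρ1 : ρ < 1) :
    ENNReal.ofReal (max (σ ^ 2 * d / (2 ^ 16 * n)) (σ ^ 2 * d / (2 ^ 31 * n ^ 2 * ρ)))
      ≤ sqPrivateRisk n (IsZCDP ρ) (gaussianModel d σ) := by
  have hn' : (0 : ℝ) < n := Nat.cast_pos.2 hn
  have hd' : (0 : ℝ) < d := Nat.cast_pos.2 (by omega)
  set γ := 1 / (2 * σ ^ 2) with hγ
  have hγ0 : 0 < γ := by positivity
  set x := 1 / (64 * √(n * γ)) with hx
  set y := 1 / (64 ^ 2 * 2 * √2 * n * √(ρ * γ)) with hy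
  have hx0 : 0 < x := by positivity
  have hy0 : 0 < y := by positivity
  have h := (gaussianModel_quadraticKLModel (d := d) hσ
    (mul_pos (lt_max_of_lt_left hx0 : 0 < max x y)
      (Real.sqrt_pos.2 hd'))).explicit_le_sqPrivateRisk_isZCDP hn hd hρ0 hρ1
  rw [← hγ, ← hx, ← hy, mul_div_cancel_right₀ _ (Real.sqrt_pos.2 hd').ne',
    min_eq_right (le_max_left x y), min_eq_right (le_max_right x y)] at h
  refine le_trans (ENNReal.ofReal_le_ofReal ?_) h
  have key := mul_max_rate_le (d := d) (c := 1) (A := σ ^ 2 * d / (2 ^ 16 * n))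
    (B := σ ^ 2 * d / (2 ^ 31 * n ^ 2 * ρ)) hx0.le hy0.le ?_ ?_
  · rwa [one_mul] at key
  · rw [hx, sq_nonprivateRadius_mul hγ0, hγ]
    refine le_of_eq ?_
    field_simp
    norm_num
  · rw [hy, sq_zcdpRadius_mul hρ0 hγ0, hγ]
    refine le_of_eq ?_
    field_simp
    norm_num

end GaussianBounds

end PrivateMinimax

theorem mainTheorem8 :
    -- the explicit lower bounds
    (∀ (𝓧 : Type u) [MeasurableSpace 𝓧] (n d : ℕ) (Θ : Set (EuclideanSpace ℝ (Fin d)))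
        (p : Θ → Measure 𝓧) (r₀ γ : ℝ),
      1 ≤ n → 66 ≤ d → PrivateMinimax.QuadraticKLModel Θ p r₀ γ →
      (ENNReal.ofReal ((min (r₀ / √d) (1 / (64 * √(n * γ)))) ^ 2 * d / 32)
          ≤ PrivateMinimax.sqRisk n p) ∧
      (∀ ε : ℝ, 0 < ε →
        ENNReal.ofReal
            ((max (min (r₀ / √d) (1 / (64 * √(n * γ))))
              (min (r₀ / √d) (√d / (64 ^ 2 * √2 * n * ε * √γ)))) ^ 2 * d / 32)
          ≤ PrivateMinimax.sqPrivateRisk n (PrivateMinimax.IsDP ε 0) p) ∧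
      (∀ ρ : ℝ, 0 < ρ → ρ < 1 →
        ENNReal.ofReal
            ((max (min (r₀ / √d) (1 / (64 * √(n * γ))))
              (min (r₀ / √d) (1 / (64 ^ 2 * 2 * √2 * n * √(ρ * γ))))) ^ 2 * d / 32)
          ≤ PrivateMinimax.sqPrivateRisk n (PrivateMinimax.IsZCDP ρ) p)) ∧
    -- the rates, all parameters being sequences indexed by the sample size
    (∀ (𝓧 : ℕ → Type u) [∀ n, MeasurableSpace (𝓧 n)] (d : ℕ → ℕ)
        (Θ : ∀ n, Set (EuclideanSpace ℝ (Fin (d n)))) (p : ∀ n, Θ n → Measure (𝓧 n))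
        (r₀ γ : ℕ → ℝ) (C : ℝ),
      (∀ n, 66 ≤ d n) → (∀ n, PrivateMinimax.QuadraticKLModel (Θ n) (p n) (r₀ n) (γ n)) →
      0 < C → (∀ n, C * √(d n) < r₀ n) →
      ((fun n : ℕ => (d n : ℝ) / (n * γ n)) =O[atTop] (fun n => r₀ n ^ 2) →
        PrivateMinimax.IsBigOmega (fun n => PrivateMinimax.sqRisk n (p n))
          (fun n => (d n : ℝ) / (n * γ n))) ∧
      (∀ ε : ℕ → ℝ, (∀ n, 0 < ε n) →
        (fun n : ℕ => max ((d n : ℝ) / (n * γ n)) ((d n : ℝ) ^ 2 / ((n * ε n) ^ 2 * γ n)))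
          =O[atTop] (fun n => r₀ n ^ 2) →
        PrivateMinimax.IsBigOmega
          (fun n => PrivateMinimax.sqPrivateRisk n (PrivateMinimax.IsDP (ε n) 0) (p n))
          (fun n => max ((d n : ℝ) / (n * γ n)) ((d n : ℝ) ^ 2 / ((n * ε n) ^ 2 * γ n)))) ∧
      (∀ ρ : ℕ → ℝ, (∀ n, 0 < ρ n) → (∀ n, ρ n < 1) →
        (fun n : ℕ => max ((d n : ℝ) / (n * γ n)) ((d n : ℝ) / ((n : ℝ) ^ 2 * ρ n * γ n)))
          =O[atTop] (fun n => r₀ n ^ 2) →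
        PrivateMinimax.IsBigOmega
          (fun n => PrivateMinimax.sqPrivateRisk n (PrivateMinimax.IsZCDP (ρ n)) (p n))
          (fun n => max ((d n : ℝ) / (n * γ n)) ((d n : ℝ) / ((n : ℝ) ^ 2 * ρ n * γ n))))) ∧
    -- Gaussian mean estimation
    (∀ (n d : ℕ) (σ : ℝ), 1 ≤ n → 66 ≤ d → 0 < σ →
      (ENNReal.ofReal (σ ^ 2 * d / (2 ^ 16 * n))
          ≤ PrivateMinimax.sqRisk n (PrivateMinimax.gaussianModel d σ)) ∧
      (PrivateMinimax.sqRisk n (PrivateMinimax.gaussianModel d σ)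
          ≤ ENNReal.ofReal (σ ^ 2 * d / n)) ∧
      (∀ ε : ℝ, 0 < ε →
        ENNReal.ofReal
            (max (σ ^ 2 * d / (2 ^ 16 * n)) (σ ^ 2 * d ^ 2 / (2 ^ 29 * (n * ε) ^ 2)))
          ≤ PrivateMinimax.sqPrivateRisk n (PrivateMinimax.IsDP ε 0)
              (PrivateMinimax.gaussianModel d σ)) ∧
      (∀ ρ : ℝ, 0 < ρ → ρ < 1 →
        ENNReal.ofReal
            (max (σ ^ 2 * d / (2 ^ 16 * n)) (σ ^ 2 * d / (2 ^ 31 * n ^ 2 * ρ)))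
          ≤ PrivateMinimax.sqPrivateRisk n (PrivateMinimax.IsZCDP ρ)
              (PrivateMinimax.gaussianModel d σ))) := by
  refine ⟨?_, ?_, ?_⟩
  · intro 𝓧 _ n d Θ p r₀ γ hn hd h
    exact ⟨h.explicit_le_sqRisk hn hd, fun ε hε => h.explicit_le_sqPrivateRisk_isDP hn hd hε,
      fun ρ hρ0 hρ1 => h.explicit_le_sqPrivateRisk_isZCDP hn hd hρ0 hρ1⟩
  · intro 𝓧 _ d Θ p r₀ γ C hd h _ _
    exact ⟨PrivateMinimax.isBigOmega_sqRisk hd h,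
      fun ε hε => PrivateMinimax.isBigOmega_sqPrivateRisk_isDP hd h hε,
      fun ρ hρ0 hρ1 => PrivateMinimax.isBigOmega_sqPrivateRisk_isZCDP hd h hρ0 hρ1⟩
  · intro n d σ hn hd hσ
    exact ⟨PrivateMinimax.le_sqRisk_gaussianModel hn hd hσ,
      PrivateMinimax.sqRisk_gaussianModel_le hn σ,
      fun ε hε => PrivateMinimax.le_sqPrivateRisk_isDP_gaussianModel hn hd hσ hε,
      fun ρ hρ0 hρ1 => PrivateMinimax.le_sqPrivateRisk_isZCDP_gaussianModel hn hd hσ hρ0 hρ1⟩
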